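/- **Lemma (three-term relations).** Let $n\ge 1$, let $q\in\mathbb C^*$ with $|q|<1$, let $\alpha,\tau\in\mathbb C$, $t=q^\tau$, and let $a_1,a_2,b_1,b_2\in\mathbb C^*$. Write $(x;q)_\infty=\prod_{i\ge 0}(1-q^ix)$, $\Delta(z)=\prod_{1\le i<j\le n}(z_i-z_j)$ and $$\Phi(z)=\prod_{i=1}^n\Big\{z_i^\alpha\prod_{r=1}^2\frac{(qa_r^{-1}z_i;q)_\infty}{(b_rz_i;q)_\infty}\Big\}\prod_{1\le j<k\le n}z_j^{2\tau-1}\frac{(qt^{-1}z_k/z_j;q)_\infty}{(tz_k/z_j;q)_\infty}.$$ For $k,i\in\{0,1,\dots,n\}$ put $$E_{k,i}(z)=z_1z_2\cdots z_k\prod_{1\le j<l\le n}(z_j-t^{-1}z_l)\prod_{j=1}^{n-i}(1-b_2z_j)\prod_{j=n-i+1}^{n}(1-a_1^{-1}z_j),$$ and let $\tilde E_{k,i}(z)=\tilde E_{k,i}(a_1,b_2;z)$ be the symmetric polynomial $$\tilde E_{k,i}(z)=\frac1{\Delta(z)}\sum_{\sigma\in S_n}(\operatorname{sgn}\sigma)\,E_{k,i}(z_{\sigma(1)},\dots,z_{\sigma(n)}).$$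 Let $\xi\in(\mathbb C^*)^n$ be such that the lattice $\{(\xi_1q^{\nu_1},\dots,\xi_nq^{\nu_n}):\nu\in\mathbb Z^n\}$ avoids the poles of the factors of $\Phi$, i.e. $b_r\xi_i\notin q^{\mathbb Z}$ for all $r,i$ and $t\,\xi_k/\xi_j\notin q^{\mathbb Z}$ for all $j<k$. For a symmetric polynomial $\phi$ let $$\langle\phi\rangle=\langle\phi,\xi\rangle=(1-q)^n\sum_{\nu\in\mathbb Z^n}\phi(z)\Phi(z)\Delta(z)\Big|_{z=(\xi_1q^{\nu_1},\dots,\xi_nq^{\nu_n})}$$ be the Jackson integral, said to converge if the sum converges absolutely; here powers along the lattice are $(\xi_iq^{\nu})^s=\xi_i^s(q^s)^\nu$, and $\xi_i^s$, $q^s$ are principal values. Let $1\le k\le n$ and $0\le i\le n-1$. 1. If $i+k\le n$ and $\langle\tilde E_{k,i}\rangle$, $\langle\tilde E_{k-1,i}\rangle$, $\langle\tilde E_{k-1,i+1}\rangle$ converge, then $$\frac{1-q^\alpha a_1a_2b_1b_2t^{2n-k-1}}{a_1t^{n-i-k}}\langle\tilde E_{k,i}\rangle=(1-q^\alpha a_2b_2t^{n+i-k})\langle\tilde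 E_{k-1,i}\rangle-(1-a_2b_2t^i)\langle\tilde E_{k-1,i+1}\rangle.$$ 2. If $i+k\ge n$ and $\langle\tilde E_{k-1,i+1}\rangle$, $\langle\tilde E_{k,i}\rangle$, $\langle\tilde E_{k,i+1}\rangle$ converge, then $$t^{n-k}(1-q^\alpha t^{n-k})\langle\tilde E_{k-1,i+1}\rangle=a_1^{-1}q^\alpha t^{n+i-k}(1-a_1b_1t^{n-i-1})\langle\tilde E_{k,i}\rangle+a_2^{-1}(1-q^\alpha a_2b_2t^{n+i-k})\langle\tilde E_{k,i+1}\rangle.$$ -/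

import Mathlib

noncomputable section

namespace JacksonSelberg

open MvPolynomial

/-! ### Symmetric interpolation polynomials -/

section Polynomials

variable {n : ℕ}

/-- The difference product `Δ(z) = ∏_{i<j} (z_i - z_j)`. -/
def vandermonde (n : ℕ) : MvPolynomial (Fin n) ℂ :=
  ∏ p : Fin n × Fin n with p.1 < p.2, (X p.1 - X p.2)

/-- The deformed difference product `Δ(t; z) = ∏_{i<j} (z_i - t⁻¹ z_j)`. -/
def vandermondeT (n : ℕ) (t : ℂ) : MvPolynomial (Fin n) ℂ :=
  ∏ p : Fin n × Fin n with p.1 < p.2, (X p.1 - C t⁻¹ * X p.2)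

/-- Skew-symmetrization `(𝒜 f)(z) = ∑_σ sgn(σ) f(z_{σ(1)}, …, z_{σ(n)})`. -/
def skew (f : MvPolynomial (Fin n) ℂ) : MvPolynomial (Fin n) ℂ :=
  ∑ σ : Equiv.Perm (Fin n), C ((Equiv.Perm.sign σ : ℤ) : ℂ) * rename σ f

/-- `E_{k,i}(a,b;z) = z_1 ⋯ z_k Δ(t;z) ∏_{j=1}^{n-i} (1 - b z_j) ∏_{j=n-i+1}^{n} (1 - a⁻¹ z_j)`.
The coordinate `z_j` is `X (j - 1)`. -/
def interp (n : ℕ) (t a b : ℂ) (k i : ℕ) : MvPolynomial (Fin n) ℂ :=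
  (∏ j : Fin n with j.val < k, X j) * vandermondeT n t
    * (∏ j : Fin n with j.val + i < n, (1 - C b * X j))
    * (∏ j : Fin n with n ≤ j.val + i, (1 - C a⁻¹ * X j))

theorem skew_rename_swap (f : MvPolynomial (Fin n) ℂ) {i j : Fin n} (hij : i ≠ j) :
    rename (Equiv.swap i j) (skew f) = - skew f := by
  unfold skew
  rw [map_sum, ← Finset.sum_neg_distrib]
  refine Fintype.sum_equiv (Equiv.mulLeft (Equiv.swap i j)) _ _ fun σ => ?_
  simp [rename_rename, Equiv.Perm.sign_swap hij, Equiv.Perm.coe_mul]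

theorem X_sub_X_dvd_skew (f : MvPolynomial (Fin n) ℂ) {i j : Fin n} (hij : i ≠ j) :
    (X i - X j : MvPolynomial (Fin n) ℂ) ∣ skew f := by
  let φ : MvPolynomial (Fin n) ℂ →ₐ[ℂ] MvPolynomial (Fin n) ℂ :=
    aeval fun l => if l = i then X j else X l
  have h0 : φ (skew f) = 0 := by
    have h1 : φ (rename (Equiv.swap i j) (skew f)) = φ (skew f) := by
      rw [← AlgHom.comp_apply]
      congr 1
      ext1 l
      by_cases h : l = i
      · subst h; simp [φ]
      · by_cases h' : l = j
        · subst h'; simp [φ]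
        · simp [φ, Equiv.swap_apply_of_ne_of_ne h h']
    rw [skew_rename_swap f hij, map_neg] at h1
    exact self_eq_neg.mp h1.symm
  let I : Ideal (MvPolynomial (Fin n) ℂ) := Ideal.span {X i - X j}
  have h2 : (Ideal.Quotient.mkₐ ℂ I).comp φ = Ideal.Quotient.mkₐ ℂ I := by
    ext1 l
    by_cases h : l = i
    · subst h
      simp only [AlgHom.comp_apply, φ, aeval_X, if_true, Ideal.Quotient.mkₐ_eq_mk]
      refine (Ideal.Quotient.eq.mpr ?_).symm
      exact Ideal.subset_span rfl
    · simp [φ, h]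
  have h3 : Ideal.Quotient.mk I (skew f) = 0 := by
    have := DFunLike.congr_fun h2 (skew f)
    rw [AlgHom.comp_apply, h0, map_zero] at this
    exact this.symm
  exact Ideal.mem_span_singleton.mp (Ideal.Quotient.eq_zero_iff_mem.mp h3)

theorem irreducible_X_sub_X {i j : Fin n} (hij : i ≠ j) :
    Irreducible (X i - X j : MvPolynomial (Fin n) ℂ) := by
  have hc : coeff (Finsupp.single i 1) (X i - X j : MvPolynomial (Fin n) ℂ) = 1 := by
    rw [coeff_sub, coeff_X, coeff_X, if_pos rfl, if_neg, sub_zero]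
    rwa [Finsupp.single_left_inj Nat.one_ne_zero, eq_comm]
  have hne : (X i - X j : MvPolynomial (Fin n) ℂ) ≠ 0 := by
    intro h
    rw [h, coeff_zero] at hc
    exact zero_ne_one hc
  refine irreducible_of_totalDegree_eq_one
    (((isHomogeneous_X ℂ i).sub (isHomogeneous_X ℂ j)).totalDegree hne) fun x hx => ?_
  exact isUnit_of_dvd_one (hc ▸ hx (Finsupp.single i 1))

theorem vandermonde_dvd_skew (f : MvPolynomial (Fin n) ℂ) : vandermonde n ∣ skew f := by
  unfold vandermonde
  refine Finset.prod_dvd_of_isRelPrime ?_ ?_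
  · intro p hp r hr hne
    simp only [Finset.coe_filter, Finset.mem_univ, true_and, Set.mem_ofPred_eq] at hp hr
    refine ((irreducible_X_sub_X hp.ne).isRelPrime_iff_not_dvd).mpr fun hd => hne ?_
    have h := map_dvd (eval fun x : Fin n => if x = p.2 then (p.1.val : ℂ) else (x.val : ℂ)) hd
    simp only [map_sub, eval_X] at h
    rw [if_neg hp.ne, if_true, sub_self, zero_dvd_iff, sub_eq_zero] at h
    have hp' : p.1.val < p.2.val := hp
    have hr' : r.1.val < r.2.val := hr
    ext1 <;> ext1 <;> split_ifs at h <;> norm_cast at h <;> grind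
  · intro p hp
    exact X_sub_X_dvd_skew f (Finset.mem_filter.mp hp).2.ne

/-- The interpolation polynomial `Ẽ_{k,i}(a,b;z) = (𝒜 E_{k,i})(z) / Δ(z)`: the polynomial whose
product with `Δ` is `𝒜 E_{k,i}`. -/
def interpSym (n : ℕ) (t a b : ℂ) (k i : ℕ) : MvPolynomial (Fin n) ℂ :=
  Classical.choose (vandermonde_dvd_skew (interp n t a b k i))

theorem vandermonde_mul_interpSym (n : ℕ) (t a b : ℂ) (k i : ℕ) :
    vandermonde n * interpSym n t a b k i = skew (interp n t a b k i) :=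
  (Classical.choose_spec (vandermonde_dvd_skew (interp n t a b k i))).symm

end Polynomials

/-! ### Jackson integrals of symmetric Selberg type -/

section Jackson

variable {n m : ℕ}

/-- The infinite `q`-shifted factorial `(x;q)_∞ = ∏_{i ≥ 0} (1 - q^i x)`, for `|q| < 1`. -/
def qPoch (q x : ℂ) : ℂ := ∏' i : ℕ, (1 - q ^ i * x)

/-- The point `(ξ_1 q^{ν_1}, …, ξ_n q^{ν_n})`. -/
def latticePt (q : ℂ) (ξ : Fin n → ℂ) (ν : Fin n → ℤ) : Fin n → ℂ :=
  fun i => ξ i * q ^ ν i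

/-- The value at `z = x q^l` of the power function `z ↦ z^s` along the `q`-lattice of `x`:
`(x q^l)^s = x^s (q^s)^l`, with the principal values of `x^s` and `q^s`. -/
def latticePow (q x s : ℂ) (l : ℤ) : ℂ := x ^ s * (q ^ s) ^ l

/-- The value of
`Φ_{n,m}(z) = ∏_i { z_i^α ∏_r (q a_r⁻¹ z_i; q)_∞ / (b_r z_i; q)_∞ }
  · ∏_{j<k} z_j^{2τ-1} (q t⁻¹ z_k / z_j; q)_∞ / (t z_k / z_j; q)_∞`,  with `t = q^τ`,
at the lattice point `z = (ξ_1 q^{ν_1}, …, ξ_n q^{ν_n})`. -/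
def Phi (q α τ : ℂ) (a b : Fin m → ℂ) (ξ : Fin n → ℂ) (ν : Fin n → ℤ) : ℂ :=
  (∏ i, (latticePow q (ξ i) α (ν i) *
      ∏ r, qPoch q (q * (a r)⁻¹ * latticePt q ξ ν i) / qPoch q (b r * latticePt q ξ ν i))) *
  ∏ p : Fin n × Fin n with p.1 < p.2,
    (latticePow q (ξ p.1) (2 * τ - 1) (ν p.1) *
      (qPoch q (q * (q ^ τ)⁻¹ * (latticePt q ξ ν p.2 / latticePt q ξ ν p.1)) /
        qPoch q (q ^ τ * (latticePt q ξ ν p.2 / latticePt q ξ ν p.1))))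

/-- The integrand `φ(z) Φ_{n,m}(z) Δ(z)` at the lattice point `z = (ξ_i q^{ν_i})_i`. -/
def integrand (q α τ : ℂ) (a b : Fin m → ℂ) (ξ : Fin n → ℂ) (φ : MvPolynomial (Fin n) ℂ)
    (ν : Fin n → ℤ) : ℂ :=
  eval (latticePt q ξ ν) φ * Phi q α τ a b ξ ν * eval (latticePt q ξ ν) (vandermonde n)

/-- The Jackson integral `⟨φ, ξ⟩` converges (absolutely). -/
def Converges (q α τ : ℂ) (a b : Fin m → ℂ) (ξ : Fin n → ℂ) (φ : MvPolynomial (Fin n) ℂ) : Prop :=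
  Summable (integrand q α τ a b ξ φ)

/-- The Jackson integral of symmetric Selberg type
`⟨φ, ξ⟩ = (1 - q)^n ∑_{ν ∈ ℤ^n} φ(z) Φ_{n,m}(z) Δ(z)` at `z = (ξ_i q^{ν_i})_i`. -/
def jackson (q α τ : ℂ) (a b : Fin m → ℂ) (ξ : Fin n → ℂ) (φ : MvPolynomial (Fin n) ℂ) : ℂ :=
  (1 - q) ^ n * ∑' ν : Fin n → ℤ, integrand q α τ a b ξ φ ν

/-- No point of the lattice `(ξ_i q^{ν_i})_i` is a pole of a factor of `Φ_{n,m}`. -/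
def PoleFree (q τ : ℂ) (b : Fin m → ℂ) (ξ : Fin n → ℂ) : Prop :=
  (∀ r i, ∀ l : ℤ, b r * ξ i * q ^ l ≠ 1) ∧
    ∀ j k, j < k → ∀ l : ℤ, q ^ τ * (ξ k / ξ j) * q ^ l ≠ 1

end Jackson

end JacksonSelberg

end

/-!
Both relations express the invariance of a lattice sum under shifts. For every `j`, the ratio of `Φ`
at `(z_1, …, q z_j, …, z_n)` and at `z` is
`q^α t^{n-1} ∏_r (1 - b_r z_j) / (1 - q a_r⁻¹ z_j) ∏_{l ≠ j} (z_j - t⁻¹ z_l) / (q t⁻¹ z_j - z_l)`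
(`Phi_add_single`). Hence, for a polynomial `Q` in `n - 1` variables, the polynomials
`∏_r (1 - z_1/a_r) ∏_{l > 1} (z_1 - t z_l) Q(z_2, …, z_n)` and
`q^α t^{2n-2} ∏_r (1 - b_r z_1) ∏_{l > 1} (z_1 - t⁻¹ z_l) Q(z_2, …, z_n)` have equal sums against
`Φ` after skew-symmetrization, as the terms of the two sums attached to a permutation `σ` differ by
the shift of the coordinate `σ(1)` (`tsum_skew_telescopeNum`). The relations are the case where `Q`
is the polynomial `E_{k-1,i}` in `n - 1` variables. Skew-symmetrization multiplies by `t⁻¹` when,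
next to `Δ(t; z)` and a factor symmetric in `z_p, z_{p+1}`, the variable `z_p` is replaced by
`z_{p+1}`; so variables can be moved inside the blocks `1, …, n-i` and `n-i+1, …, n` of equal linear
factors. This turns both skew-symmetrizations into combinations of the three `𝒜 E`'s of the relation
(`skew_interp_mul_X_last_of_le`, `skew_omitMonomial_zero_of_le` and their counterparts for
`n ≤ i + k`).

Convergence is the delicate point: the three integrals are assumed to converge, which makes the two
skew-symmetrized sums converge, but the individual terms, one for each permutation, need not be
summable: leading coefficients of the `𝒜 E`'s vanish for instance when `t` is a root of unity, and
then nothing is left to control the terms. So they cannot be shifted separately. Instead, every term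
`g` has an asymptotic expansion along each ray `±1_S` of the chambers `ν_{σ(1)} ≥ ν_{σ(2)} ≥ ⋯` of
`ℤⁿ` cut at `0`: up to an error that is as small as desired, it is a sum of eigenfunctions of
translation by the ray. A polynomial in that translation kills the eigenfunctions, and the
composition `L` of these operators over all rays makes `g` summable (`exists_summable_translate`).
Sums against the character `exp (iθ(ν₁ + ⋯ + νₙ))` get multiplied by a trigonometric polynomial in
`θ` under `L`; this polynomial vanishes for countably many `θ` at most, because the rays have
nonzero coordinate sums. Therefore the shift identity, valid after applying `L`, holds for all other
`θ`, and by continuity for `θ = 0` (`tsum_sum_eq_tsum_sum_shift`).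
-/

noncomputable section

namespace JacksonSelberg

open MvPolynomial

/-! ### Translation operators on functions on `ℤⁿ` -/

section Translations

variable {n : ℕ}

/-- The action of the group algebra of `ℤⁿ` on functions on `ℤⁿ`, the basis element `u` acting by
`f ↦ f (· + u)`. -/
def translate : AddMonoidAlgebra ℂ (Fin n → ℤ) →ₐ[ℂ] Module.End ℂ ((Fin n → ℤ) → ℂ) :=
  AddMonoidAlgebra.lift ℂ _ (Fin n → ℤ)
    { toFun := fun u => LinearMap.funLeft ℂ ℂ (fun ν => ν + u.toAdd)
      map_one' := by ext f ν; simp [LinearMap.funLeft_apply]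
      map_mul' := fun u v => by
        ext f ν
        simp [LinearMap.funLeft_apply, add_comm, add_left_comm] }

theorem translate_single (u : Fin n → ℤ) (a : ℂ) (f : (Fin n → ℤ) → ℂ) (ν : Fin n → ℤ) :
    translate (AddMonoidAlgebra.single u a) f ν = a * f (ν + u) := by
  simp [translate, AddMonoidAlgebra.lift_single, LinearMap.funLeft_apply]

theorem translate_shift (c : AddMonoidAlgebra ℂ (Fin n → ℤ)) (u : Fin n → ℤ)
    (f : (Fin n → ℤ) → ℂ) (ν : Fin n → ℤ) :
    translate c (fun ν => f (ν + u)) ν = translate c f (ν + u) := by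
  have h (g : (Fin n → ℤ) → ℂ) :
      (fun ν => g (ν + u)) = translate (AddMonoidAlgebra.single u 1) g := by
    ext ν; rw [translate_single, one_mul]
  rw [h f, ← Module.End.mul_apply, ← map_mul, mul_comm, map_mul, Module.End.mul_apply,
    translate_single, one_mul]

/-- The unitary character `ν ↦ exp (iθ(ν₁ + ⋯ + νₙ))`. -/
def phase (θ : ℝ) (ν : Fin n → ℤ) : ℂ := Complex.exp ((θ * ((∑ i, ν i : ℤ) : ℝ) : ℝ) * Complex.I)

theorem norm_phase (θ : ℝ) (ν : Fin n → ℤ) : ‖phase θ ν‖ = 1 :=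
  Complex.norm_exp_ofReal_mul_I _

theorem phase_add (θ : ℝ) (μ ν : Fin n → ℤ) : phase θ (μ + ν) = phase θ μ * phase θ ν := by
  rw [phase, phase, phase, ← Complex.exp_add]
  congr 1
  push_cast [Pi.add_apply, Finset.sum_add_distrib]
  ring

theorem phase_zero_left (ν : Fin n → ℤ) : phase 0 ν = 1 := by simp [phase]

theorem phase_zero_right (θ : ℝ) : phase θ (0 : Fin n → ℤ) = 1 := by simp [phase]

theorem summable_phase_mul {f : (Fin n → ℤ) → ℂ} (hf : Summable f) (θ : ℝ) :
    Summable fun ν => phase θ ν * f ν := by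
  rw [← summable_norm_iff] at hf ⊢
  simpa [norm_phase] using hf

theorem continuous_tsum_phase_mul {f : (Fin n → ℤ) → ℂ} (hf : Summable f) :
    Continuous fun θ => ∑' ν, phase θ ν * f ν := by
  refine continuous_tsum (u := fun ν => ‖f ν‖) (fun ν => ?_) hf.norm fun ν θ => ?_
  · unfold phase; fun_prop
  · simp [norm_phase]

/-- The factor by which an element of the group algebra multiplies the sum of a summable function
against `phase θ`. -/
def phaseMass (θ : ℝ) : AddMonoidAlgebra ℂ (Fin n → ℤ) →ₐ[ℂ] ℂ :=
  AddMonoidAlgebra.lift ℂ _ (Fin n → ℤ)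
    { toFun := fun u => phase θ (-u.toAdd)
      map_one' := by simp [phase_zero_right]
      map_mul' := fun u v => by rw [← phase_add]; congr 1; simp [add_comm] }

theorem phaseMass_single (θ : ℝ) (u : Fin n → ℤ) (a : ℂ) :
    phaseMass θ (AddMonoidAlgebra.single u a) = a * phase θ (-u) := by
  simp [phaseMass, AddMonoidAlgebra.lift_single]

theorem hasSum_translate {f : (Fin n → ℤ) → ℂ} (hf : Summable f) (θ : ℝ)
    (c : AddMonoidAlgebra ℂ (Fin n → ℤ)) :
    HasSum (fun ν => phase θ ν * translate c f ν) (phaseMass θ c * ∑' ν, phase θ ν * f ν) := by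
  induction c using AddMonoidAlgebra.induction_linear with
  | zero => simp
  | add c d hc hd =>
    simpa [mul_add, add_mul] using hc.add hd
  | single u a =>
    have h := (summable_phase_mul hf θ).hasSum
    rw [← (Equiv.addRight u).hasSum_iff] at h
    rw [phaseMass_single]
    refine (h.mul_left (a * phase θ (-u))).congr_fun fun ν => ?_
    rw [translate_single, Function.comp_apply, Equiv.coe_addRight, phase_add]
    have : phase θ (-u) * phase θ u = 1 := by
      rw [← phase_add, neg_add_cancel, phase_zero_right]
    linear_combination (- phase θ ν * a * f (ν + u)) * this

end Translations

/-! ### Annihilation of sums of eigenfunctions -/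

section Eigen

variable {n : ℕ}

/-- The algebra spanned by the eigenfunctions of translation by `v`. -/
def eigenAlgebra (v : Fin n → ℤ) : Subalgebra ℂ ((Fin n → ℤ) → ℂ) :=
  Algebra.adjoin ℂ {F | ∃ μ : ℂ, ∀ ν, F (ν + v) = μ * F ν}

theorem mem_eigenAlgebra {v : Fin n → ℤ} {F : (Fin n → ℤ) → ℂ} (μ : ℂ)
    (h : ∀ ν, F (ν + v) = μ * F ν) : F ∈ eigenAlgebra v :=
  Algebra.subset_adjoin ⟨μ, h⟩

theorem exists_polynomial_annihilating {v : Fin n → ℤ} {F : (Fin n → ℤ) → ℂ}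
    (hF : F ∈ eigenAlgebra v) : ∃ p : Polynomial ℂ, p ≠ 0 ∧
      translate (Polynomial.aeval (AddMonoidAlgebra.single v 1) p) F = 0 := by
  let S : Submonoid ((Fin n → ℤ) → ℂ) :=
    { carrier := {F | ∃ μ : ℂ, ∀ ν, F (ν + v) = μ * F ν}
      one_mem' := ⟨1, by simp⟩
      mul_mem' := by
        rintro F G ⟨μ, hF⟩ ⟨κ, hG⟩
        exact ⟨μ * κ, fun ν => by simp only [Pi.mul_apply, hF, hG]; ring⟩ }
  have hF' : F ∈ Submodule.span ℂ (S : Set ((Fin n → ℤ) → ℂ)) := by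
    have : F ∈ Subalgebra.toSubmodule (Algebra.adjoin ℂ (S : Set ((Fin n → ℤ) → ℂ))) := hF
    rwa [Algebra.adjoin_eq_span, Submonoid.closure_eq] at this
  clear hF
  induction hF' using Submodule.span_induction with
  | mem F h =>
    obtain ⟨μ, h⟩ := h
    refine ⟨Polynomial.X - Polynomial.C μ, Polynomial.X_sub_C_ne_zero μ, ?_⟩
    ext ν
    simp [translate_single, h]
  | zero => exact ⟨1, one_ne_zero, by simp⟩
  | add F G _ _ hF hG =>
    obtain ⟨p, hp, hpF⟩ := hF
    obtain ⟨r, hr, hrG⟩ := hG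
    refine ⟨p * r, mul_ne_zero hp hr, ?_⟩
    rw [map_add, map_mul, map_mul, Module.End.mul_apply, Module.End.mul_apply, hrG, map_zero,
      add_zero, ← Module.End.mul_apply, ← map_mul, mul_comm, map_mul, Module.End.mul_apply, hpF,
      map_zero]
  | smul a F _ hF =>
    obtain ⟨p, hp, hpF⟩ := hF
    exact ⟨p, hp, by rw [map_smul, hpF, smul_zero]⟩

theorem countable_phaseMass_aeval_eq_zero {v : Fin n → ℤ} (hv : ∑ i, v i ≠ 0) {p : Polynomial ℂ}
    (hp : p ≠ 0) :
    {θ | phaseMass θ (Polynomial.aeval (AddMonoidAlgebra.single v (1 : ℂ)) p) = 0}.Countable := by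
  have h (θ : ℝ) : phaseMass θ (Polynomial.aeval (AddMonoidAlgebra.single v (1 : ℂ)) p) =
      p.eval (phase θ (-v)) := by
    rw [← Polynomial.aeval_algHom_apply, phaseMass_single, one_mul, Polynomial.coe_aeval_eq_eval]
  have hs : (((∑ i, v i : ℤ) : ℝ)) ≠ 0 := by exact_mod_cast hv
  have hfib (r : ℂ) : {θ : ℝ | phase θ (-v) = r}.Countable := by
    by_cases hr : ∃ θ₀, phase θ₀ (-v) = r
    · obtain ⟨θ₀, rfl⟩ := hr
      refine (Set.countable_range fun l : ℤ =>
        θ₀ - l * (2 * Real.pi) / ((∑ i, v i : ℤ) : ℝ)).mono fun θ hθ => ?_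
      obtain ⟨l, hl⟩ := Complex.exp_eq_exp_iff_exists_int.mp hθ
      refine ⟨l, ?_⟩
      have h2 : ((θ * ((∑ i, (-v) i : ℤ) : ℝ) : ℝ) : ℂ) =
          ((θ₀ * ((∑ i, (-v) i : ℤ) : ℝ) + l * (2 * Real.pi) : ℝ) : ℂ) := by
        refine mul_right_cancel₀ Complex.I_ne_zero (hl.trans ?_)
        push_cast; ring
      have h3 := Complex.ofReal_injective h2
      simp only [Pi.neg_apply, Finset.sum_neg_distrib, Int.cast_neg] at h3
      simp only
      field_simp
      linarith
    · convert Set.countable_empty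
      ext θ
      simpa using fun h => hr ⟨θ, h⟩
  refine ((p.roots.toFinset.countable_toSet).biUnion fun r _ => hfib r).mono fun θ hθ => ?_
  rw [Set.mem_ofPred_eq, h] at hθ
  simp only [Set.mem_iUnion]
  exact ⟨_, by simpa [hp] using hθ, rfl⟩

end Eigen

/-! ### Expansions along the rays of the chambers of `ℤⁿ` -/

section Expansions

variable {n : ℕ}

/-- The `ℓ¹` norm on `ℤⁿ`, as a natural number. -/
def size (ν : Fin n → ℤ) : ℕ := ∑ i, (ν i).natAbs

theorem size_add_le (μ ν : Fin n → ℤ) : size (μ + ν) ≤ size μ + size ν := by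
  rw [size, size, size, ← Finset.sum_add_distrib]
  exact Finset.sum_le_sum fun i _ => Int.natAbs_add_le _ _

theorem natAbs_le_size (ν : Fin n → ℤ) (i : Fin n) : (ν i).natAbs ≤ size ν :=
  Finset.single_le_sum (f := fun i => (ν i).natAbs) (fun _ _ => Nat.zero_le _) (Finset.mem_univ i)

theorem summable_pow_size (n : ℕ) {r : ℝ} (hr0 : 0 ≤ r) (hr1 : r < 1) :
    Summable fun ν : Fin n → ℤ => r ^ size ν := by
  have h1 : Summable fun l : ℤ => r ^ l.natAbs := by
    refine summable_int_iff_summable_nat_and_neg.mpr ⟨?_, ?_⟩ <;>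
      simpa using summable_geometric_of_lt_one hr0 hr1
  induction n with
  | zero => exact Summable.of_finite
  | succ n ih =>
    have h2 := h1.mul_of_nonneg ih (fun _ => by positivity) (fun _ => by positivity)
    rw [← (Fin.consEquiv fun _ : Fin (n + 1) => ℤ).summable_iff]
    refine h2.congr fun p => ?_
    simp [size, Fin.sum_univ_succ, pow_add, Fin.consEquiv]

/-- The points of `ℤⁿ` at depth at least `g` inside the union of the chambers that have `v` on
their boundary. The chambers are cut out by the hyperplanes `ν_i = 0` and `ν_i = ν_j`, and the
condition bears on the hyperplanes that do not contain `v`. -/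
def region (v : Fin n → ℤ) (g : ℕ) : Set (Fin n → ℤ) :=
  {ν | (∀ i, v i ≠ 0 → (g : ℤ) ≤ v i * ν i) ∧
    ∀ i j, v i ≠ v j → (g : ℤ) ≤ (v i - v j) * (ν i - ν j)}

theorem region_anti (v : Fin n → ℤ) {g g' : ℕ} (h : g ≤ g') : region v g' ⊆ region v g := by
  have h' : (g : ℤ) ≤ g' := by exact_mod_cast h
  exact fun ν hν => ⟨fun i hi => h'.trans (hν.1 i hi), fun i j hij => h'.trans (hν.2 i j hij)⟩

theorem exists_add_mem_region (v u : Fin n → ℤ) :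
    ∃ d : ℕ, ∀ g, ∀ ν ∈ region v (g + d), ν + u ∈ region v g := by
  refine ⟨∑ i, (v i * u i).natAbs + ∑ p : Fin n × Fin n,
    ((v p.1 - v p.2) * (u p.1 - u p.2)).natAbs, fun g ν hν => ⟨fun i hi => ?_, fun i j hij => ?_⟩⟩
  · have h1 := hν.1 i hi
    have h2 : (v i * u i).natAbs ≤ ∑ i, (v i * u i).natAbs :=
      Finset.single_le_sum (f := fun i => (v i * u i).natAbs) (fun _ _ => Nat.zero_le _)
        (Finset.mem_univ i)
    rw [Pi.add_apply, mul_add]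
    rw [Nat.cast_add, Nat.cast_add] at h1
    omega
  · have h1 := hν.2 i j hij
    have h2 := Finset.single_le_sum
      (f := fun p : Fin n × Fin n => ((v p.1 - v p.2) * (u p.1 - u p.2)).natAbs)
      (fun _ _ => Nat.zero_le _) (Finset.mem_univ (i, j))
    have h3 : (v i - v j) * ((ν + u) i - (ν + u) j) =
      (v i - v j) * (ν i - ν j) + (v i - v j) * (u i - u j) := by
      simp only [Pi.add_apply]; ring
    rw [h3]
    rw [Nat.cast_add, Nat.cast_add] at h1
    simp only at h2
    omega

/-- The primitive vectors on the rays of the chambers of `ℤⁿ`: the vectors `± 1_S` for nonempty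
sets `S` of coordinates. -/
def rays (n : ℕ) : Set (Fin n → ℤ) :=
  {v | ∃ ε : ℤ, (ε = 1 ∨ ε = -1) ∧ ∃ S : Finset (Fin n), S.Nonempty ∧
    v = fun i => if i ∈ S then ε else 0}

theorem finite_rays (n : ℕ) : (rays n).Finite := by
  refine (Set.finite_range fun p : Bool × Finset (Fin n) => fun i : Fin n =>
    if i ∈ p.2 then (if p.1 then (1 : ℤ) else -1) else 0).subset ?_
  rintro v ⟨ε, hε | hε, S, -, rfl⟩
  · exact ⟨(true, S), by simp [hε]⟩
  · exact ⟨(false, S), by simp [hε]⟩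

theorem sum_ne_zero_of_mem_rays {v : Fin n → ℤ} (hv : v ∈ rays n) : ∑ i, v i ≠ 0 := by
  obtain ⟨ε, hε, S, hS, rfl⟩ := hv
  have : ε ≠ 0 := by omega
  simp [Finset.sum_ite_mem, this, hS.ne_empty]

/-- A point with a large coordinate lies deep inside the region of some ray: the `n` gaps
`(kg, (k+1)g)`, `k < n`, cannot all contain a coordinate, as some coordinate is at least `ng`. -/
theorem exists_mem_region (ν : Fin n → ℤ) (g : ℕ) (i₀ : Fin n) (h : n * g ≤ (ν i₀).natAbs) :
    ∃ v ∈ rays n, ν ∈ region v g := by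
  obtain ⟨ε, hε, hεi⟩ : ∃ ε : ℤ, (ε = 1 ∨ ε = -1) ∧ ((n * g : ℕ) : ℤ) ≤ ε * ν i₀ := by
    rcases le_total 0 (ν i₀) with h0 | h0
    · exact ⟨1, Or.inl rfl, by omega⟩
    · exact ⟨-1, Or.inr rfl, by omega⟩
  obtain ⟨k, hk⟩ : ∃ k : Fin n, ∀ j, ¬ ((k * g : ℤ) < ε * ν j ∧ ε * ν j < (k + 1) * g) := by
    by_contra! hcon
    choose J hJ using hcon
    have hmono {k l : Fin n} (hkl : k < l) : ((k : ℤ) + 1) * g ≤ l * g := by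
      have : (k : ℤ) + 1 ≤ l := by exact_mod_cast hkl
      gcongr
    have hinj : Function.Injective J := by
      intro k l hkl
      have hk := hJ k
      have hl := hJ l
      rw [hkl] at hk
      rcases lt_trichotomy k l with h | h | h
      · have := hmono h; omega
      · exact h
      · have := hmono h; omega
    obtain ⟨k, hk⟩ := Finite.surjective_of_injective hinj i₀
    have h1 := (hJ k).2
    rw [hk] at h1
    have h2 : ((k : ℤ) + 1) * g ≤ n * g := by
      have : (k : ℤ) + 1 ≤ n := by exact_mod_cast k.2
      gcongr
    push_cast at hεi
    omega
  have hkg : (0 : ℤ) ≤ k * g := by positivity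
  have hkg' : ((k : ℤ) + 1) * g = k * g + g := by ring
  have hε2 : ε * ε = 1 := by rcases hε with rfl | rfl <;> rfl
  refine ⟨_, ⟨ε, hε, Finset.univ.filter fun j => ((k : ℤ) + 1) * g ≤ ε * ν j, ⟨i₀, ?_⟩, rfl⟩,
    fun i hi => ?_, fun i j hij => ?_⟩
  · have : ((k : ℤ) + 1) * g ≤ n * g := by
      have : (k : ℤ) + 1 ≤ n := by exact_mod_cast k.2
      gcongr
    push_cast at hεi
    simpa using this.trans hεi
  · simp only [Finset.mem_filter, Finset.mem_univ, true_and, ne_eq, ite_eq_right_iff,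
      Classical.not_imp] at hi ⊢
    rw [if_pos hi.1]
    omega
  · have h1 := hk i
    have h2 := hk j
    have h3 : ε * (ν i - ν j) = ε * ν i - ε * ν j := by ring
    have h4 : (0 - ε) * (ν i - ν j) = ε * ν j - ε * ν i := by ring
    simp only [Finset.mem_filter, Finset.mem_univ, true_and] at hij ⊢
    split_ifs at hij ⊢ with h5 h6 h6
    · exact absurd rfl hij
    · rw [sub_zero, h3]; omega
    · rw [h4]; omega
    · exact absurd rfl hij

/-- `f` has an asymptotic expansion along `v`: up to an error of arbitrarily high order in
`‖q‖ ^ g`, on the points at depth `g`, it is a combination of eigenfunctions of translation by `v`.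
The exponential growth rate `K` is not allowed to depend on the order `N`, so that a large `N`
makes the error decay. -/
def Expansible (q : ℂ) (v : Fin n → ℤ) (f : (Fin n → ℤ) → ℂ) : Prop :=
  ∃ K : ℝ, 1 ≤ K ∧ ∀ N : ℕ, ∃ F ∈ eigenAlgebra v, ∃ C : ℝ, 0 ≤ C ∧
    (∀ ν ∈ region v 0, ‖F ν‖ ≤ C * K ^ size ν) ∧
    ∀ g, ∀ ν ∈ region v g, ‖f ν - F ν‖ ≤ C * K ^ size ν * ‖q‖ ^ (N * g)

theorem Expansible.of_mem_eigenAlgebra {q : ℂ} {v : Fin n → ℤ} {f : (Fin n → ℤ) → ℂ}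
    (hf : f ∈ eigenAlgebra v) {K C : ℝ} (hK : 1 ≤ K) (hC : 0 ≤ C)
    (h : ∀ ν, ‖f ν‖ ≤ C * K ^ size ν) : Expansible q v f :=
  ⟨K, hK, fun _ => ⟨f, hf, C, hC, fun ν _ => h ν, fun g ν _ => by
    rw [sub_self, norm_zero]; positivity⟩⟩

theorem Expansible.const (q : ℂ) (v : Fin n → ℤ) (a : ℂ) : Expansible q v fun _ => a :=
  .of_mem_eigenAlgebra (mem_eigenAlgebra 1 fun _ => (one_mul a).symm) le_rfl (norm_nonneg a)
    fun ν => by simp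

theorem Expansible.add {q : ℂ} {v : Fin n → ℤ} {f f' : (Fin n → ℤ) → ℂ} (hf : Expansible q v f)
    (hf' : Expansible q v f') : Expansible q v fun ν => f ν + f' ν := by
  obtain ⟨K, hK, h⟩ := hf
  obtain ⟨K', hK', h'⟩ := hf'
  refine ⟨max K K', le_max_of_le_left hK, fun N => ?_⟩
  obtain ⟨F, hF, C, hC, hb, he⟩ := h N
  obtain ⟨F', hF', C', hC', hb', he'⟩ := h' N
  have hKm (ν : Fin n → ℤ) : K ^ size ν ≤ max K K' ^ size ν :=
    pow_le_pow_left₀ (by linarith) (le_max_left _ _) _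
  have hKm' (ν : Fin n → ℤ) : K' ^ size ν ≤ max K K' ^ size ν :=
    pow_le_pow_left₀ (by linarith) (le_max_right _ _) _
  refine ⟨F + F', add_mem hF hF', C + C', by positivity, fun ν hν => ?_, fun g ν hν => ?_⟩
  · calc ‖F ν + F' ν‖ ≤ C * K ^ size ν + C' * K' ^ size ν :=
          (norm_add_le _ _).trans (add_le_add (hb ν hν) (hb' ν hν))
      _ ≤ C * max K K' ^ size ν + C' * max K K' ^ size ν := by gcongr <;> simp
      _ = _ := by ring
  · calc ‖f ν + f' ν - (F ν + F' ν)‖ = ‖(f ν - F ν) + (f' ν - F' ν)‖ := by congr 1; ring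
      _ ≤ C * K ^ size ν * ‖q‖ ^ (N * g) + C' * K' ^ size ν * ‖q‖ ^ (N * g) :=
          (norm_add_le _ _).trans (add_le_add (he g ν hν) (he' g ν hν))
      _ ≤ C * max K K' ^ size ν * ‖q‖ ^ (N * g) + C' * max K K' ^ size ν * ‖q‖ ^ (N * g) := by
          gcongr <;> simp
      _ = _ := by ring

theorem Expansible.mul {q : ℂ} (hq : ‖q‖ < 1) {v : Fin n → ℤ} {f f' : (Fin n → ℤ) → ℂ}
    (hf : Expansible q v f) (hf' : Expansible q v f') : Expansible q v fun ν => f ν * f' ν := by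
  obtain ⟨K, hK, h⟩ := hf
  obtain ⟨K', hK', h'⟩ := hf'
  refine ⟨K * K', one_le_mul_of_one_le_of_one_le hK hK', fun N => ?_⟩
  obtain ⟨F, hF, C, hC, hb, he⟩ := h N
  obtain ⟨F', hF', C', hC', hb', he'⟩ := h' N
  have hb2 (ν) (hν : ν ∈ region v 0) : ‖F ν * F' ν‖ ≤ C * C' * (K * K') ^ size ν := by
    rw [norm_mul, mul_pow]
    calc ‖F ν‖ * ‖F' ν‖ ≤ (C * K ^ size ν) * (C' * K' ^ size ν) :=
          mul_le_mul (hb ν hν) (hb' ν hν) (norm_nonneg _) (by positivity)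
      _ = _ := by ring
  refine ⟨F * F', mul_mem hF hF', 3 * (C * C'), by positivity, fun ν hν => ?_, fun g ν hν => ?_⟩
  · refine (hb2 ν hν).trans ?_
    have : 0 ≤ (K * K') ^ size ν := pow_nonneg (mul_nonneg (by linarith) (by linarith)) _
    exact mul_le_mul_of_nonneg_right (by linarith [mul_nonneg hC hC']) this
  · have hν0 := region_anti v (Nat.zero_le g) hν
    have hq1 : ‖q‖ ^ (N * g) ≤ 1 := pow_le_one₀ (norm_nonneg q) hq.le
    have hK0 : 0 ≤ K := by linarith
    have hK0' : 0 ≤ K' := by linarith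
    set Q := ‖q‖ ^ (N * g)
    have hQ : 0 ≤ Q := by positivity
    set A := C * K ^ size ν
    set A' := C' * K' ^ size ν
    have hA : 0 ≤ A := by positivity
    have hA' : 0 ≤ A' := by positivity
    have e1 := he g ν hν
    have e2 := he' g ν hν
    have b1 := hb ν hν0
    have b2 := hb' ν hν0
    calc ‖f ν * f' ν - F ν * F' ν‖
        = ‖(f ν - F ν) * (f' ν - F' ν) + (f ν - F ν) * F' ν + F ν * (f' ν - F' ν)‖ := by
          congr 1; ring
      _ ≤ ‖f ν - F ν‖ * ‖f' ν - F' ν‖ + ‖f ν - F ν‖ * ‖F' ν‖ + ‖F ν‖ * ‖f' ν - F' ν‖ := by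
          refine (norm_add₃_le).trans ?_
          simp only [norm_mul, le_refl]
      _ ≤ (A * Q) * (A' * 1) + (A * Q) * A' + A * (A' * Q) := by
          have e3 : ‖f' ν - F' ν‖ ≤ A' * 1 := e2.trans (by gcongr)
          gcongr
      _ = 3 * (C * C') * (K * K') ^ size ν * Q := by
          simp only [A, A', mul_pow]; ring

theorem Expansible.prod {q : ℂ} (hq : ‖q‖ < 1) {v : Fin n → ℤ} {ι : Type*} (s : Finset ι)
    (f : ι → (Fin n → ℤ) → ℂ) (hf : ∀ i ∈ s, Expansible q v (f i)) :
    Expansible q v fun ν => ∏ i ∈ s, f i ν := by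
  classical
  induction s using Finset.induction_on with
  | empty => simpa using Expansible.const q v 1
  | insert i s hi ih =>
    simp only [Finset.prod_insert hi]
    exact (hf i (Finset.mem_insert_self i s)).mul hq
      (ih fun j hj => hf j (Finset.mem_insert_of_mem hj))

theorem exists_translate_bound {v : Fin n → ℤ} {E : (Fin n → ℤ) → ℂ} {K C Q : ℝ} (hK : 1 ≤ K)
    (hC : 0 ≤ C) (hQ : 0 ≤ Q) (hE : ∀ g, ∀ ν ∈ region v g, ‖E ν‖ ≤ C * K ^ size ν * Q ^ g)
    (c : AddMonoidAlgebra ℂ (Fin n → ℤ)) :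
    ∃ (d : ℕ) (C' : ℝ), 0 ≤ C' ∧
      ∀ g, ∀ ν ∈ region v (g + d), ‖translate c E ν‖ ≤ C' * K ^ size ν * Q ^ g := by
  induction c using AddMonoidAlgebra.induction_linear with
  | zero => exact ⟨0, 0, le_rfl, fun g ν _ => by simp⟩
  | add a b ha hb =>
    obtain ⟨d, D, hD, h⟩ := ha
    obtain ⟨d', D', hD', h'⟩ := hb
    refine ⟨max d d', D + D', by positivity, fun g ν hν => ?_⟩
    rw [map_add, LinearMap.add_apply, Pi.add_apply]
    have h1 := h g ν (region_anti v (by gcongr; exact le_max_left _ _) hν)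
    have h2 := h' g ν (region_anti v (by gcongr; exact le_max_right _ _) hν)
    calc _ ≤ _ := norm_add_le _ _
      _ ≤ D * K ^ size ν * Q ^ g + D' * K ^ size ν * Q ^ g := add_le_add h1 h2
      _ = _ := by ring
  | single u a =>
    obtain ⟨d, hd⟩ := exists_add_mem_region v u
    have hK0 : 0 ≤ K := by linarith
    refine ⟨d, ‖a‖ * (C * K ^ size u), by positivity, fun g ν hν => ?_⟩
    rw [translate_single, norm_mul]
    calc ‖a‖ * ‖E (ν + u)‖ ≤ ‖a‖ * (C * K ^ size (ν + u) * Q ^ g) := by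
          gcongr; exact hE g _ (hd g ν hν)
      _ ≤ ‖a‖ * (C * K ^ (size ν + size u) * Q ^ g) := by
          gcongr
          exact size_add_le ν u
      _ = _ := by rw [pow_add]; ring

/-- A function with expansions along all rays becomes summable under a finite composition of
polynomials in translations, whose effect on sums against a character `phase θ` is invertible for
all but countably many `θ`. -/
theorem exists_summable_translate {q : ℂ} (hq0 : q ≠ 0) (hq1 : ‖q‖ < 1) (hn : 0 < n)
    {f : (Fin n → ℤ) → ℂ} (hf : ∀ v ∈ rays n, Expansible q v f) :
    ∃ c : AddMonoidAlgebra ℂ (Fin n → ℤ), {θ | phaseMass θ c = 0}.Countable ∧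
      Summable (translate c f) := by
  classical
  set V := (finite_rays n).toFinset with hV
  have hVr {v : Fin n → ℤ} : v ∈ V ↔ v ∈ rays n := Set.Finite.mem_toFinset _
  choose! K hK1 hK using hf
  set K₀ : ℝ := 1 + ∑ v ∈ V, K v with hK₀
  have hKnn : ∀ v ∈ V, 0 ≤ K v := fun v hv => by linarith [hK1 v (hVr.mp hv)]
  have hK₀1 : 1 ≤ K₀ := by linarith [Finset.sum_nonneg hKnn]
  have hKle : ∀ v ∈ V, K v ≤ K₀ := fun v hv => by
    linarith [Finset.single_le_sum hKnn hv]
  -- the order of the expansions is chosen so that the errors beat the growth rate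
  obtain ⟨N₀, hN₀⟩ : ∃ N₀ : ℕ, K₀ * ‖q‖ ^ N₀ < 1 / 2 := by
    have h := (tendsto_pow_atTop_nhds_zero_of_lt_one (norm_nonneg q) hq1).const_mul K₀
    rw [mul_zero] at h
    exact (h.eventually_lt_const (by norm_num)).exists
  set N := n * n * N₀ with hN
  choose! F hF C hC _ hE using fun v hv => hK v hv N
  choose! p hp0 hpF using fun v hv => exists_polynomial_annihilating (hF v hv)
  set P : (Fin n → ℤ) → AddMonoidAlgebra ℂ (Fin n → ℤ) :=
    fun v => Polynomial.aeval (AddMonoidAlgebra.single v 1) (p v) with hP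
  set c := ∏ v ∈ V, P v with hc
  refine ⟨c, ?_, ?_⟩
  · refine (V.countable_toSet.biUnion fun v hv => countable_phaseMass_aeval_eq_zero
      (sum_ne_zero_of_mem_rays (hVr.mp hv)) (hp0 v (hVr.mp hv))).mono fun θ hθ => ?_
    rw [Set.mem_ofPred_eq, hc, map_prod, Finset.prod_eq_zero_iff] at hθ
    obtain ⟨v, hv, h⟩ := hθ
    exact Set.mem_biUnion hv h
  have hcF : ∀ v ∈ V, translate c (F v) = 0 := fun v hv => by
    rw [hc, ← Finset.prod_erase_mul _ _ hv, map_mul, Module.End.mul_apply,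
      hpF v (hVr.mp hv), map_zero]
  have hbound : ∀ v ∈ V, ∃ (d : ℕ) (C' : ℝ), 0 ≤ C' ∧ ∀ g, ∀ ν ∈ region v (g + d),
      ‖translate c f ν‖ ≤ C' * K₀ ^ size ν * (‖q‖ ^ N) ^ g := fun v hv => by
    have h := exists_translate_bound (E := f - F v) hK₀1 (hC v (hVr.mp hv))
      (by positivity : 0 ≤ ‖q‖ ^ N) (fun g ν hν => (hE v (hVr.mp hv) g ν hν).trans ?_) c
    · rwa [map_sub, hcF v hv, sub_zero] at h
    · rw [pow_mul]
      have := hC v (hVr.mp hv)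
      have := hKnn v hv
      gcongr
      exact hKle v hv
  choose! d C' hC' hd using hbound
  set D := ∑ v ∈ V, d v with hD
  set C₀ := ∑ v ∈ V, C' v with hC₀
  have hqpos : 0 < ‖q‖ := norm_pos_iff.mpr hq0
  have hne : Nonempty (Fin n) := ⟨⟨0, hn⟩⟩
  have hC₀nn : 0 ≤ C₀ := Finset.sum_nonneg hC'
  refine Summable.of_norm_bounded_eventually (g := fun ν => C₀ * ((‖q‖ ^ N) ^ (D + 1))⁻¹ *
    (1 / 2) ^ size ν) ((summable_pow_size n (by norm_num) (by norm_num)).mul_left _) ?_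
  have hfin : {ν : Fin n → ℤ | ∀ i, (ν i).natAbs ≤ n * D}.Finite := by
    refine (Set.finite_Icc (fun _ => -((n * D : ℕ) : ℤ)) (fun _ => ((n * D : ℕ) : ℤ))).subset
      fun ν hν => ⟨fun i => ?_, fun i => ?_⟩ <;>
    · have := hν i
      simp only
      omega
  filter_upwards [hfin.compl_mem_cofinite] with ν hν
  obtain ⟨i₀, hi₀⟩ := Finite.exists_max fun i => (ν i).natAbs
  have hlarge : n * D < (ν i₀).natAbs := by
    by_contra! h
    exact hν fun i => (hi₀ i).trans h
  set g := (ν i₀).natAbs / n with hg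
  have hDg : D ≤ g := (Nat.le_div_iff_mul_le hn).mpr (by rw [mul_comm]; exact hlarge.le)
  have hsize : size ν ≤ n * n * (g + 1) := by
    have h1 : size ν ≤ n * (ν i₀).natAbs := by
      refine (Finset.sum_le_sum fun i _ => hi₀ i).trans ?_
      simp
    have h2 : (ν i₀).natAbs ≤ n * (g + 1) := (Nat.lt_mul_div_succ _ hn).le
    calc size ν ≤ n * (n * (g + 1)) := h1.trans (Nat.mul_le_mul_left n h2)
      _ = _ := by ring
  obtain ⟨v, hv, hvν⟩ := exists_mem_region ν g i₀ (Nat.mul_div_le _ _)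
  have hv' : v ∈ V := hVr.mpr hv
  have hdD : d v ≤ D := Finset.single_le_sum (fun _ _ => Nat.zero_le _) hv'
  have hmem : ν ∈ region v (g - D + d v) := region_anti v (by omega) hvν
  have hQpos : 0 < (‖q‖ ^ N) ^ (D + 1) := by positivity
  have hdecay : (‖q‖ ^ N) ^ (g - D) ≤ ((‖q‖ ^ N) ^ (D + 1))⁻¹ * (‖q‖ ^ N₀) ^ size ν := by
    rw [inv_mul_eq_div, le_div_iff₀ hQpos, ← pow_add, show g - D + (D + 1) = g + 1 by omega,
      ← pow_mul, ← pow_mul]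
    refine pow_le_pow_of_le_one hqpos.le hq1.le ?_
    calc N₀ * size ν ≤ N₀ * (n * n * (g + 1)) := Nat.mul_le_mul_left _ hsize
      _ = N * (g + 1) := by rw [hN]; ring
  calc ‖translate c f ν‖ ≤ C' v * K₀ ^ size ν * (‖q‖ ^ N) ^ (g - D) := hd v hv' _ ν hmem
    _ ≤ C₀ * K₀ ^ size ν * (((‖q‖ ^ N) ^ (D + 1))⁻¹ * (‖q‖ ^ N₀) ^ size ν) := by
        gcongr
        exact Finset.single_le_sum hC' hv'
    _ = C₀ * ((‖q‖ ^ N) ^ (D + 1))⁻¹ * (K₀ * ‖q‖ ^ N₀) ^ size ν := by rw [mul_pow]; ring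
    _ ≤ C₀ * ((‖q‖ ^ N) ^ (D + 1))⁻¹ * (1 / 2) ^ size ν := by gcongr

theorem summable_comp_add {f : (Fin n → ℤ) → ℂ} (hf : Summable f) (u : Fin n → ℤ) :
    Summable fun ν => f (ν + u) :=
  (Equiv.addRight u).summable_iff.mpr hf

theorem phase_single_one (θ : ℝ) (i : Fin n) :
    phase θ (-Pi.single i (1 : ℤ)) = Complex.exp (-(θ * Complex.I)) := by
  simp [phase]

theorem tsum_phase_mul_comp_add (f : (Fin n → ℤ) → ℂ) (θ : ℝ) (u : Fin n → ℤ) :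
    ∑' ν, phase θ ν * f (ν + u) = phase θ (-u) * ∑' ν, phase θ ν * f ν := by
  rw [← (Equiv.addRight u).tsum_eq fun ν => phase θ ν * f ν, ← tsum_mul_left]
  refine tsum_congr fun ν => ?_
  have : phase θ (-u) * phase θ u = 1 := by
    rw [← phase_add, neg_add_cancel, phase_zero_right]
  rw [Equiv.coe_addRight, phase_add]
  linear_combination (-phase θ ν * f (ν + u)) * this

/-- The sums of `∑_s g_s` and of the sum of the shifts of the `g_s` by basis vectors agree, though
the `g_s` themselves need not be summable. -/
theorem tsum_sum_eq_tsum_sum_shift {q : ℂ} (hq0 : q ≠ 0) (hq1 : ‖q‖ < 1) (hn : 0 < n)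
    {ι : Type*} [Fintype ι] (g : ι → (Fin n → ℤ) → ℂ) (e : ι → Fin n)
    (hg : ∀ s, ∀ v ∈ rays n, Expansible q v (g s))
    (hG : Summable fun ν => ∑ s, g s ν)
    (hH : Summable fun ν : Fin n → ℤ => ∑ s, g s (ν + Pi.single (e s) (1 : ℤ))) :
    ∑' ν, ∑ s, g s ν = ∑' ν : Fin n → ℤ, ∑ s, g s (ν + Pi.single (e s) (1 : ℤ)) := by
  classical
  choose c hc hcs using fun s => exists_summable_translate hq0 hq1 hn (hg s)
  set L := ∏ s, c s with hL
  have hLs (s : ι) : Summable (translate L (g s)) := by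
    have h := (hasSum_translate (hcs s) 0 (∏ r ∈ Finset.univ.erase s, c r)).summable
    simp only [phase_zero_left, one_mul] at h
    rwa [← Module.End.mul_apply, ← map_mul, Finset.prod_erase_mul _ _ (Finset.mem_univ s)] at h
  set G := fun ν => ∑ s, g s ν with hGdef
  set H := fun ν : Fin n → ℤ => ∑ s, g s (ν + Pi.single (e s) (1 : ℤ)) with hHdef
  -- translation by a basis vector multiplies sums against `phase θ` by a scalar independent of `s`
  have hkey (θ : ℝ) : phaseMass θ L * ∑' ν, phase θ ν * H ν =
      Complex.exp (-(θ * Complex.I)) * (phaseMass θ L * ∑' ν, phase θ ν * G ν) := by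
    rw [← (hasSum_translate hH θ L).tsum_eq, ← (hasSum_translate hG θ L).tsum_eq]
    have hG' : translate L G = fun ν => ∑ s, translate L (g s) ν := by
      have : G = ∑ s, g s := by ext ν; simp [G]
      rw [this, map_sum]; ext ν; simp
    have hH' : translate L H = fun ν => ∑ s, translate L (g s) (ν + Pi.single (e s) 1) := by
      have : H = ∑ s, fun ν : Fin n → ℤ => g s (ν + Pi.single (e s) (1 : ℤ)) := by ext ν; simp [H]
      rw [this, map_sum]; ext ν; simp [translate_shift L]
    rw [hG', hH']
    simp only [Finset.mul_sum]
    rw [Summable.tsum_finsetSum fun s _ => summable_phase_mul (hLs s) θ,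
      Summable.tsum_finsetSum fun s _ => summable_phase_mul
        (summable_comp_add (hLs s) (Pi.single (e s) 1)) θ, Finset.mul_sum]
    exact Finset.sum_congr rfl fun s _ => by
      rw [tsum_phase_mul_comp_add, phase_single_one]
  have hdense : Dense {θ | phaseMass θ L = 0}ᶜ := by
    refine Set.Countable.dense_compl ℝ ((Set.countable_iUnion hc).mono fun θ hθ => ?_)
    rw [Set.mem_ofPred_eq, hL, map_prod, Finset.prod_eq_zero_iff] at hθ
    obtain ⟨s, -, h⟩ := hθ
    exact Set.mem_iUnion.mpr ⟨s, h⟩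
  have hfun : (fun θ : ℝ => ∑' ν, phase θ ν * H ν) =
      fun θ : ℝ => Complex.exp (-(θ * Complex.I)) * ∑' ν, phase θ ν * G ν := by
    refine Continuous.ext_on hdense (continuous_tsum_phase_mul hH)
      (Continuous.mul (by fun_prop) (continuous_tsum_phase_mul hG)) fun θ hθ => ?_
    refine mul_left_cancel₀ (a := phaseMass θ L) hθ ((hkey θ).trans ?_)
    ring
  simpa [phase_zero_left] using (congrFun hfun 0).symm

end Expansions

/-! ### Asymptotics of ratios of infinite `q`-shifted factorials -/

section QPochhammer

open Filter Topology Asymptotics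

theorem summable_norm_pow_mul {q : ℂ} (hq : ‖q‖ < 1) (x : ℂ) :
    Summable fun i : ℕ => ‖-(q ^ i * x)‖ := by
  simpa using (summable_geometric_of_lt_one (norm_nonneg q) hq).mul_right ‖x‖

theorem qPoch_eq_mul {q : ℂ} (hq : ‖q‖ < 1) (x : ℂ) :
    qPoch q x = (1 - x) * qPoch q (q * x) := by
  have h (x : ℂ) : Multipliable fun i : ℕ => 1 - q ^ i * x := by
    simpa only [sub_eq_add_neg] using multipliable_one_add_of_summable (summable_norm_pow_mul hq x)
  have h2 (i : ℕ) : q ^ (i + 1) * x = q ^ i * (q * x) := by ring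
  unfold qPoch
  rw [tprod_eq_zero_mul']
  · simp [h2]
  · simpa only [h2] using h (q * x)

theorem qPoch_zero (q : ℂ) : qPoch q 0 = 1 := by simp [qPoch]

theorem differentiable_qPoch {q : ℂ} (hq : ‖q‖ < 1) : Differentiable ℂ (qPoch q) := by
  intro x₀
  have h : HasProdLocallyUniformlyOn (fun (i : ℕ) (x : ℂ) => 1 + -(q ^ i * x))
      (fun x => ∏' i : ℕ, (1 + -(q ^ i * x))) (Metric.ball 0 (‖x₀‖ + 1)) := by
    refine Summable.hasProdLocallyUniformlyOn_nat_one_add Metric.isOpen_ball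
      ((summable_geometric_of_lt_one (norm_nonneg q) hq).mul_right (‖x₀‖ + 1))
      (.of_forall fun i x hx => ?_) fun i => by fun_prop
    rw [norm_neg, norm_mul, norm_pow]
    gcongr
    exact (mem_ball_zero_iff.mp hx).le
  have h2 := h.differentiableOn (.of_forall fun s => by
    simpa [Finset.prod_fn] using DifferentiableOn.finsetProd (u := s) (fun _ _ => by fun_prop))
    Metric.isOpen_ball
  have h3 : qPoch q = fun x => ∏' i : ℕ, (1 + -(q ^ i * x)) := by
    ext x; simp [qPoch, sub_eq_add_neg]
  rw [h3]
  exact h2.differentiableAt (Metric.isOpen_ball.mem_nhds (by simp))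

theorem analyticAt_qPoch_mul_div {q : ℂ} (hq : ‖q‖ < 1) (x y : ℂ) :
    AnalyticAt ℂ (fun X => qPoch q (x * X) / qPoch q (y * X)) 0 := by
  have h (x : ℂ) : AnalyticAt ℂ (fun X => qPoch q (x * X)) 0 :=
    ((differentiable_qPoch hq).comp (differentiable_id.const_mul x)).analyticAt 0
  refine (h x).fun_div (h y) ?_
  simp [qPoch_zero]

theorem AnalyticAt.exists_polynomial_isBigO {h : ℂ → ℂ} (hh : AnalyticAt ℂ h 0) (N : ℕ) :
    ∃ p : Polynomial ℂ, (fun X => h X - p.eval X) =O[𝓝 0] fun X => X ^ N := by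
  obtain ⟨s, hs⟩ := hh
  refine ⟨∑ l ∈ Finset.range N, Polynomial.C (s.coeff l) * Polynomial.X ^ l, ?_⟩
  have h1 := hs.isBigO_sub_partialSum_pow N
  refine (h1.congr_left fun X => ?_).trans (isBigO_of_le _ fun X => by simp)
  rw [zero_add, FormalMultilinearSeries.partialSum, Polynomial.eval_finsetSum]
  congr 1
  refine Finset.sum_congr rfl fun l _ => ?_
  rw [FormalMultilinearSeries.apply_eq_pow_smul_coeff, Polynomial.eval_mul, Polynomial.eval_pow,
    Polynomial.eval_C, Polynomial.eval_X, smul_eq_mul, mul_comm]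

/-- `ψ(m) ∼ ρ^m (c₀ + c₁ q^m + c₂ q^{2m} + ⋯)` as `m → ∞`, for some `ρ ≠ 0`. -/
def HasExpansion (q : ℂ) (ψ : ℕ → ℂ) : Prop :=
  ∃ ρ : ℂ, ρ ≠ 0 ∧ ∀ N : ℕ, ∃ p : Polynomial ℂ, ∃ C : ℝ, 0 ≤ C ∧
    ∀ m : ℕ, ‖ψ m - ρ ^ m * p.eval (q ^ m)‖ ≤ C * ‖ρ‖ ^ m * ‖q‖ ^ (N * m)

theorem HasExpansion.of_eventually {q : ℂ} (hq0 : q ≠ 0) (hq1 : ‖q‖ < 1) {ψ : ℕ → ℂ} {ρ : ℂ}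
    (hρ : ρ ≠ 0) {h : ℂ → ℂ} (hh : AnalyticAt ℂ h 0)
    (hψ : ∀ᶠ m in atTop, ψ m = ρ ^ m * h (q ^ m)) : HasExpansion q ψ := by
  refine ⟨ρ, hρ, fun N => ?_⟩
  obtain ⟨p, hp⟩ := AnalyticAt.exists_polynomial_isBigO hh N
  have h1 := hp.comp_tendsto (tendsto_pow_atTop_nhds_zero_of_norm_lt_one hq1)
  have h2 : (fun m => ψ m - ρ ^ m * p.eval (q ^ m)) =O[atTop]
      fun m : ℕ => ρ ^ m * (q ^ m) ^ N := by
    refine ((isBigO_refl (fun m : ℕ => ρ ^ m) atTop).mul h1).congr' ?_ .rfl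
    filter_upwards [hψ] with m hm
    simp only [Function.comp_apply, hm]
    ring
  obtain ⟨C, hC, hb⟩ := bound_of_isBigO_nat_atTop h2
  refine ⟨p, C, hC.le, fun m => (hb ?_).trans_eq ?_⟩
  · exact mul_ne_zero (pow_ne_zero _ hρ) (pow_ne_zero _ (pow_ne_zero _ hq0))
  · rw [norm_mul, norm_pow, norm_pow, norm_pow, ← pow_mul, mul_comm m N, mul_assoc]

theorem hasExpansion_qPoch_pos {q : ℂ} (hq0 : q ≠ 0) (hq1 : ‖q‖ < 1) (x y : ℂ) :
    HasExpansion q fun m => qPoch q (x * q ^ m) / qPoch q (y * q ^ m) :=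
  .of_eventually hq0 hq1 one_ne_zero (analyticAt_qPoch_mul_div hq1 x y)
    (.of_forall fun m => by simp)

/-- The recursion satisfied by `m ↦ (x q^{-m}; q)_∞ / (y q^{-m}; q)_∞` is that of
`m ↦ (x / y)^m (q^{m+1} / y; q)_∞ / (q^{m+1} / x; q)_∞`. -/
theorem hasExpansion_qPoch_neg {q : ℂ} (hq0 : q ≠ 0) (hq1 : ‖q‖ < 1) {x y : ℂ} (hx : x ≠ 0)
    (hy : y ≠ 0) (hpole : ∀ l : ℤ, y * q ^ l ≠ 1) :
    HasExpansion q fun m => qPoch q (x * q ^ (-(m : ℤ))) / qPoch q (y * q ^ (-(m : ℤ))) := by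
  set ψ : ℕ → ℂ := fun m => qPoch q (x * q ^ (-(m : ℤ))) / qPoch q (y * q ^ (-(m : ℤ))) with hψ
  have hlim (x : ℂ) : ∀ᶠ m : ℕ in atTop, qPoch q (q / x * q ^ m) ≠ 0 := by
    have h1 : Tendsto (fun m : ℕ => qPoch q (q / x * q ^ m)) atTop (𝓝 (qPoch q (q / x * 0))) :=
      ((differentiable_qPoch hq1).continuous.tendsto _).comp
        ((tendsto_pow_atTop_nhds_zero_of_norm_lt_one hq1).const_mul _)
    rw [mul_zero, qPoch_zero] at h1
    exact h1.eventually_ne one_ne_zero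
  obtain ⟨M, hM⟩ := eventually_atTop.mp ((hlim x).and (hlim y))
  have hrec (m : ℕ) : ψ (m + 1) * (y * (1 - q ^ (m + 1) / y)) =
      ψ m * (x * (1 - q ^ (m + 1) / x)) := by
    have e1 : q ^ (-((m + 1 : ℕ) : ℤ)) * q = q ^ (-(m : ℤ)) := by
      rw [← zpow_add_one₀ hq0]; congr 1; push_cast; ring
    have e2 : q ^ (-((m + 1 : ℕ) : ℤ)) * q ^ (m + 1) = 1 := by
      rw [zpow_neg, zpow_natCast, inv_mul_cancel₀ (pow_ne_zero _ hq0)]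
    have e3 (z : ℂ) : qPoch q (z * q ^ (-((m + 1 : ℕ) : ℤ))) =
        (1 - z * q ^ (-((m + 1 : ℕ) : ℤ))) * qPoch q (z * q ^ (-(m : ℤ))) := by
      rw [qPoch_eq_mul hq1, ← e1]; congr 2; ring
    have e4 : (1 - y * q ^ (-((m + 1 : ℕ) : ℤ))) ≠ 0 := fun h =>
      hpole (-((m + 1 : ℕ) : ℤ)) (sub_eq_zero.mp h).symm
    simp only [hψ]
    rw [e3 x, e3 y, mul_div_mul_comm, mul_one_sub y, mul_one_sub x, mul_div_cancel₀ _ hx,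
      mul_div_cancel₀ _ hy]
    have e5 : (1 - x * q ^ (-((m + 1 : ℕ) : ℤ))) / (1 - y * q ^ (-((m + 1 : ℕ) : ℤ))) *
        (y - q ^ (m + 1)) = x - q ^ (m + 1) := by
      rw [div_mul_eq_mul_div, div_eq_iff e4]
      linear_combination (x - y) * e2
    linear_combination (qPoch q (x * q ^ (-(m : ℤ))) / qPoch q (y * q ^ (-(m : ℤ)))) * e5
  set D : ℕ → ℂ := fun m => qPoch q (q / y * q ^ m) / qPoch q (q / x * q ^ m) with hD
  have hDne : ∀ m ≥ M, D m ≠ 0 := fun m hm => div_ne_zero (hM m hm).2 (hM m hm).1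
  have hfac {z : ℂ} (hz : ∀ m ≥ M, qPoch q (q / z * q ^ m) ≠ 0) (m : ℕ) (hm : M ≤ m) :
      1 - q ^ (m + 1) / z ≠ 0 := by
    intro h
    refine hz m hm ?_
    rw [qPoch_eq_mul hq1, show q / z * q ^ m = q ^ (m + 1) / z by ring, h, zero_mul]
  have hDrec (m : ℕ) (hm : M ≤ m) : D (m + 1) * (1 - q ^ (m + 1) / y) =
      D m * (1 - q ^ (m + 1) / x) := by
    have e3 (z : ℂ) : qPoch q (q / z * q ^ m) =
        (1 - q ^ (m + 1) / z) * qPoch q (q / z * q ^ (m + 1)) := by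
      rw [qPoch_eq_mul hq1]
      congr 2 <;> ring
    have hx' := hfac (fun m hm => (hM m hm).1) m hm
    simp only [hD]
    rw [e3 x, e3 y, mul_div_mul_comm]
    rw [mul_right_comm (_ / _), div_mul_cancel₀ _ hx', mul_comm]
  have hsol : ∀ m ≥ M, ψ m = ψ M * (x / y) ^ (m - M) * (D m / D M) := by
    intro m hm
    induction m, hm using Nat.le_induction with
    | base => rw [Nat.sub_self, pow_zero, mul_one, div_self (hDne M le_rfl), mul_one]
    | succ m hm ih =>
      have hy' := hfac (fun m hm => (hM m hm).2) m hm
      refine mul_right_cancel₀ (mul_ne_zero hy hy') ?_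
      rw [hrec, ih, Nat.sub_add_comm hm, pow_succ]
      have h2 : D (m + 1) * (1 - q ^ (m + 1) / y) / D M = D m * (1 - q ^ (m + 1) / x) / D M := by
        rw [hDrec m hm]
      calc ψ M * (x / y) ^ (m - M) * (D m / D M) * (x * (1 - q ^ (m + 1) / x))
          = ψ M * (x / y) ^ (m - M) * x * (D m * (1 - q ^ (m + 1) / x) / D M) := by ring
        _ = ψ M * (x / y) ^ (m - M) * (x / y * y) *
            (D (m + 1) * (1 - q ^ (m + 1) / y) / D M) := by rw [h2, div_mul_cancel₀ _ hy]
        _ = _ := by ring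
  refine .of_eventually hq0 hq1 (div_ne_zero hx hy) (h := fun X => (ψ M / ((x / y) ^ M * D M)) *
    (qPoch q (q / y * X) / qPoch q (q / x * X)))
    (analyticAt_const.mul (analyticAt_qPoch_mul_div hq1 _ _)) ?_
  filter_upwards [eventually_ge_atTop M] with m hm
  have hxy : (x / y) ^ m = (x / y) ^ (m - M) * (x / y) ^ M := by
    rw [← pow_add, Nat.sub_add_cancel hm]
  have hxy0 : (x / y) ^ M ≠ 0 := pow_ne_zero _ (div_ne_zero hx hy)
  rw [hsol m hm, hxy]
  simp only [hD]
  field_simp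

end QPochhammer

/-! ### Expansibility of the factors of the integrand -/

section Factors

variable {n : ℕ}

theorem zpow_comp_mem_eigenAlgebra (v : Fin n → ℤ) (ℓ : (Fin n → ℤ) →+ ℤ) {ρ : ℂ} (hρ : ρ ≠ 0) :
    (fun ν => ρ ^ ℓ ν) ∈ eigenAlgebra v :=
  mem_eigenAlgebra (ρ ^ ℓ v) fun ν => by rw [map_add, zpow_add₀ hρ, mul_comm]

theorem Expansible.comp_of_le {q : ℂ} (hq0 : q ≠ 0) (hq1 : ‖q‖ < 1) {v : Fin n → ℤ} {ψ : ℤ → ℂ}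
    (hψ : HasExpansion q fun m => ψ m) (ℓ : (Fin n → ℤ) →+ ℤ)
    (hℓ : ∀ ν, (ℓ ν).natAbs ≤ size ν) (h : ∀ g : ℕ, ∀ ν ∈ region v g, (g : ℤ) ≤ ℓ ν) :
    Expansible q v fun ν => ψ (ℓ ν) := by
  obtain ⟨ρ, hρ, hψ⟩ := hψ
  refine ⟨max 1 ‖ρ‖, le_max_left _ _, fun N => ?_⟩
  obtain ⟨p, C, hC, hp⟩ := hψ N
  have hrho {m : ℕ} {ν : Fin n → ℤ} (hm : m ≤ size ν) : ‖ρ‖ ^ m ≤ max 1 ‖ρ‖ ^ size ν :=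
    (pow_le_pow_left₀ (norm_nonneg _) (le_max_right _ _) _).trans
      (pow_le_pow_right₀ (le_max_left _ _) hm)
  have hnat {ν : Fin n → ℤ} {g : ℕ} (hν : ν ∈ region v g) :
      ∃ m : ℕ, ℓ ν = m ∧ m ≤ size ν ∧ g ≤ m := by
    have h1 := h g ν hν
    have h2 := hℓ ν
    exact ⟨(ℓ ν).toNat, by omega, by omega, by omega⟩
  have hpb : ∀ m : ℕ, ‖p.eval (q ^ m)‖ ≤ ∑ l ∈ Finset.range (p.natDegree + 1), ‖p.coeff l‖ := by
    intro m
    rw [Polynomial.eval_eq_sum_range]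
    refine norm_sum_le_of_le _ fun l _ => ?_
    rw [norm_mul, norm_pow, norm_pow]
    exact mul_le_of_le_one_right (norm_nonneg _)
      (pow_le_one₀ (by positivity) (pow_le_one₀ (norm_nonneg _) hq1.le))
  set B := ∑ l ∈ Finset.range (p.natDegree + 1), ‖p.coeff l‖ with hB
  have hB0 : 0 ≤ B := by positivity
  refine ⟨(fun ν => ρ ^ ℓ ν) * Polynomial.aeval (fun ν => q ^ ℓ ν) p, mul_mem
    (zpow_comp_mem_eigenAlgebra v ℓ hρ) ?_, C + B, by positivity, fun ν hν => ?_, fun g ν hν => ?_⟩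
  · rw [Polynomial.aeval_eq_sum_range]
    exact sum_mem fun l _ => Subalgebra.smul_mem _
      (pow_mem (zpow_comp_mem_eigenAlgebra v ℓ hq0) l) _
  all_goals
    obtain ⟨m, hm, hms, hmg⟩ := hnat hν
    have hF : ((fun ν => ρ ^ ℓ ν) * Polynomial.aeval (fun ν => q ^ ℓ ν) p) ν =
        ρ ^ m * p.eval (q ^ m) := by
      simp [Polynomial.aeval_eq_sum_range, Polynomial.eval_eq_sum_range, hm]
    rw [hF]
  · rw [norm_mul, norm_pow, mul_comm]
    exact mul_le_mul ((hpb m).trans (by linarith)) (hrho hms) (by positivity) (by positivity)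
  · simp only [hm]
    refine (hp m).trans ?_
    have h1 : ‖q‖ ^ (N * m) ≤ ‖q‖ ^ (N * g) :=
      pow_le_pow_of_le_one (norm_nonneg _) hq1.le (Nat.mul_le_mul_left N hmg)
    have h2 := hrho hms
    gcongr
    linarith

theorem HasExpansion.exists_norm_le {q : ℂ} (hq1 : ‖q‖ < 1) {ψ : ℕ → ℂ} (hψ : HasExpansion q ψ) :
    ∃ K C : ℝ, 1 ≤ K ∧ 0 ≤ C ∧ ∀ m, ‖ψ m‖ ≤ C * K ^ m := by
  obtain ⟨ρ, hρ, hψ⟩ := hψ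
  obtain ⟨p, C, hC, hp⟩ := hψ 0
  refine ⟨max 1 ‖ρ‖, C + ∑ l ∈ Finset.range (p.natDegree + 1), ‖p.coeff l‖, le_max_left _ _,
    by positivity, fun m => ?_⟩
  have hpb : ‖p.eval (q ^ m)‖ ≤ ∑ l ∈ Finset.range (p.natDegree + 1), ‖p.coeff l‖ := by
    rw [Polynomial.eval_eq_sum_range]
    refine norm_sum_le_of_le _ fun l _ => ?_
    rw [norm_mul, norm_pow, norm_pow]
    exact mul_le_of_le_one_right (norm_nonneg _)
      (pow_le_one₀ (by positivity) (pow_le_one₀ (norm_nonneg _) hq1.le))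
  have h1 := hp m
  rw [zero_mul, pow_zero, mul_one] at h1
  have h2 : ‖ρ‖ ^ m ≤ max 1 ‖ρ‖ ^ m := pow_le_pow_left₀ (norm_nonneg _) (le_max_right _ _) _
  calc ‖ψ m‖ = ‖(ψ m - ρ ^ m * p.eval (q ^ m)) + ρ ^ m * p.eval (q ^ m)‖ := by congr 1; ring
    _ ≤ C * ‖ρ‖ ^ m + ‖ρ‖ ^ m * ∑ l ∈ Finset.range (p.natDegree + 1), ‖p.coeff l‖ := by
        refine (norm_add_le _ _).trans (add_le_add h1 ?_)
        rw [norm_mul, norm_pow]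
        gcongr
    _ = (C + ∑ l ∈ Finset.range (p.natDegree + 1), ‖p.coeff l‖) * ‖ρ‖ ^ m := by ring
    _ ≤ _ := by gcongr

/-- A function of one linear form with expansions at both ends is expansible along every vector `v`
on which the linear form vanishes or in whose regions it has a definite sign. -/
theorem Expansible.comp_linear {q : ℂ} (hq0 : q ≠ 0) (hq1 : ‖q‖ < 1) {v : Fin n → ℤ} {ψ : ℤ → ℂ}
    (hψ : HasExpansion q fun m => ψ m) (hψ' : HasExpansion q fun m => ψ (-(m : ℤ)))
    (ℓ : (Fin n → ℤ) →+ ℤ) (hℓ : ∀ ν, (ℓ ν).natAbs ≤ size ν)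
    (h : ℓ v = 0 ∨ (∀ g : ℕ, ∀ ν ∈ region v g, (g : ℤ) ≤ ℓ ν) ∨
      ∀ g : ℕ, ∀ ν ∈ region v g, (g : ℤ) ≤ -ℓ ν) :
    Expansible q v fun ν => ψ (ℓ ν) := by
  rcases h with h | h | h
  · obtain ⟨K, C, hK, hC, hb⟩ := hψ.exists_norm_le hq1
    obtain ⟨K', C', hK', hC', hb'⟩ := hψ'.exists_norm_le hq1
    refine .of_mem_eigenAlgebra (K := max K K') (C := C + C')
      (mem_eigenAlgebra 1 fun ν => by rw [map_add, h, add_zero, one_mul])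
      (le_max_of_le_left hK) (by positivity) fun ν => ?_
    have hpow {k : ℝ} (hk : 1 ≤ k) (hk' : k ≤ max K K') :
        k ^ (ℓ ν).natAbs ≤ max K K' ^ size ν :=
      (pow_le_pow_left₀ (by linarith) hk' _).trans
        (pow_le_pow_right₀ (le_max_of_le_left hK) (hℓ ν))
    have hpos : 0 ≤ max K K' ^ size ν := pow_nonneg (by linarith [le_max_left K K']) _
    rcases Int.natAbs_eq (ℓ ν) with h0 | h0
    · rw [h0]
      refine (hb _).trans ((mul_le_mul_of_nonneg_left (hpow hK (le_max_left _ _)) hC).trans ?_)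
      exact mul_le_mul_of_nonneg_right (by linarith) hpos
    · rw [h0]
      refine (hb' _).trans ((mul_le_mul_of_nonneg_left (hpow hK' (le_max_right _ _)) hC').trans ?_)
      exact mul_le_mul_of_nonneg_right (by linarith) hpos
  · exact .comp_of_le hq0 hq1 hψ ℓ hℓ h
  · have := Expansible.comp_of_le hq0 hq1 (ψ := fun m => ψ (-m)) hψ' (-ℓ)
      (fun ν => by simpa using hℓ ν) (by simpa using h)
    simpa using this

theorem Expansible.comp_apply {q : ℂ} (hq0 : q ≠ 0) (hq1 : ‖q‖ < 1) {v : Fin n → ℤ}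
    (hv : v ∈ rays n) {ψ : ℤ → ℂ} (hψ : HasExpansion q fun m => ψ m)
    (hψ' : HasExpansion q fun m => ψ (-(m : ℤ))) (i : Fin n) :
    Expansible q v fun ν => ψ (ν i) := by
  refine .comp_linear hq0 hq1 hψ hψ' (Pi.evalAddMonoidHom (fun _ => ℤ) i)
    (fun ν => natAbs_le_size ν i) ?_
  obtain ⟨ε, hε, S, -, rfl⟩ := hv
  by_cases hi : i ∈ S
  · rcases hε with rfl | rfl
    · refine Or.inr (Or.inl fun g ν hν => ?_)
      simpa [hi] using hν.1 i
    · refine Or.inr (Or.inr fun g ν hν => ?_)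
      simpa [hi] using hν.1 i
  · exact Or.inl (by simp [hi])

theorem Expansible.comp_sub {q : ℂ} (hq0 : q ≠ 0) (hq1 : ‖q‖ < 1) {v : Fin n → ℤ}
    (hv : v ∈ rays n) {ψ : ℤ → ℂ} (hψ : HasExpansion q fun m => ψ m)
    (hψ' : HasExpansion q fun m => ψ (-(m : ℤ))) {i j : Fin n} (hij : i ≠ j) :
    Expansible q v fun ν => ψ (ν i - ν j) := by
  refine .comp_linear hq0 hq1 hψ hψ'
    (Pi.evalAddMonoidHom (fun _ => ℤ) i - Pi.evalAddMonoidHom (fun _ => ℤ) j)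
    (fun ν => ?_) ?_
  · have h : (ν i).natAbs + (ν j).natAbs ≤ size ν := by
      rw [← Finset.sum_pair (f := fun i => (ν i).natAbs) hij]
      exact Finset.sum_le_sum_of_subset (Finset.subset_univ _)
    simp only [AddMonoidHom.sub_apply, Pi.evalAddMonoidHom_apply]
    omega
  obtain ⟨ε, hε, S, -, rfl⟩ := hv
  by_cases hi : i ∈ S <;> by_cases hj : j ∈ S
  · exact Or.inl (by simp [hi, hj])
  · rcases hε with rfl | rfl
    · refine Or.inr (Or.inl fun g ν hν => ?_)
      simpa [hi, hj] using hν.2 i j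
    · refine Or.inr (Or.inr fun g ν hν => ?_)
      simpa [hi, hj] using hν.2 i j
  · rcases hε with rfl | rfl
    · refine Or.inr (Or.inr fun g ν hν => ?_)
      simpa [hi, hj] using hν.2 i j
    · refine Or.inr (Or.inl fun g ν hν => ?_)
      simpa [hi, hj] using hν.2 i j
  · exact Or.inl (by simp [hi, hj])

end Factors

section Integrand

variable {n m : ℕ}

theorem hasExpansion_const_mul_zpow {q : ℂ} (hq0 : q ≠ 0) (hq1 : ‖q‖ < 1) (c : ℂ) {ρ : ℂ}
    (hρ : ρ ≠ 0) : HasExpansion q (fun l => c * ρ ^ (l : ℤ)) ∧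
      HasExpansion q fun l => c * ρ ^ (-(l : ℤ)) :=
  ⟨.of_eventually hq0 hq1 hρ (h := fun _ => c) analyticAt_const
      (.of_forall fun l => by simp [mul_comm]),
    .of_eventually hq0 hq1 (inv_ne_zero hρ) (h := fun _ => c) analyticAt_const
      (.of_forall fun l => by simp [mul_comm])⟩

theorem expansible_latticePow {q : ℂ} (hq0 : q ≠ 0) (hq1 : ‖q‖ < 1) {v : Fin n → ℤ}
    (hv : v ∈ rays n) (x s : ℂ) (i : Fin n) :
    Expansible q v fun ν => latticePow q x s (ν i) := by
  have hs : q ^ s ≠ 0 := by simp [Complex.cpow_eq_zero_iff, hq0]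
  obtain ⟨h, h'⟩ := hasExpansion_const_mul_zpow hq0 hq1 (x ^ s) hs
  exact .comp_apply hq0 hq1 hv (ψ := latticePow q x s) h h' i

theorem expansible_latticePt {q : ℂ} (hq0 : q ≠ 0) (hq1 : ‖q‖ < 1) {v : Fin n → ℤ}
    (hv : v ∈ rays n) (ξ : Fin n → ℂ) (i : Fin n) :
    Expansible q v fun ν => latticePt q ξ ν i := by
  obtain ⟨h, h'⟩ := hasExpansion_const_mul_zpow hq0 hq1 (ξ i) hq0
  exact .comp_apply hq0 hq1 hv (ψ := fun l => ξ i * q ^ l) h h' i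

theorem expansible_eval {q : ℂ} (hq0 : q ≠ 0) (hq1 : ‖q‖ < 1) {v : Fin n → ℤ}
    (hv : v ∈ rays n) (ξ : Fin n → ℂ) (P : MvPolynomial (Fin n) ℂ) :
    Expansible q v fun ν => eval (latticePt q ξ ν) P := by
  induction P using MvPolynomial.induction_on with
  | C c => simpa using Expansible.const q v c
  | add P Q hP hQ => simpa using hP.add hQ
  | mul_X P i hP => simpa using hP.mul hq1 (expansible_latticePt hq0 hq1 hv ξ i)

theorem hasExpansion_qPoch_div {q : ℂ} (hq0 : q ≠ 0) (hq1 : ‖q‖ < 1) {x y : ℂ} (hx : x ≠ 0)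
    (hy : y ≠ 0) (hpole : ∀ l : ℤ, y * q ^ l ≠ 1) :
    HasExpansion q (fun l => qPoch q (x * q ^ (l : ℤ)) / qPoch q (y * q ^ (l : ℤ))) ∧
      HasExpansion q fun l => qPoch q (x * q ^ (-(l : ℤ))) / qPoch q (y * q ^ (-(l : ℤ))) :=
  ⟨by simpa using hasExpansion_qPoch_pos hq0 hq1 x y, hasExpansion_qPoch_neg hq0 hq1 hx hy hpole⟩

theorem latticePt_div {q : ℂ} (hq0 : q ≠ 0) (ξ : Fin n → ℂ) (ν : Fin n → ℤ) (i j : Fin n) :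
    latticePt q ξ ν i / latticePt q ξ ν j = ξ i / ξ j * q ^ (ν i - ν j) := by
  rw [latticePt, latticePt, mul_div_mul_comm, zpow_sub₀ hq0]

theorem expansible_Phi {q α τ : ℂ} (hq0 : q ≠ 0) (hq1 : ‖q‖ < 1) {a b : Fin m → ℂ}
    (ha : ∀ r, a r ≠ 0) (hb : ∀ r, b r ≠ 0) {ξ : Fin n → ℂ} (hξ : ∀ j, ξ j ≠ 0)
    (hpole : PoleFree q τ b ξ) {v : Fin n → ℤ} (hv : v ∈ rays n) :
    Expansible q v (Phi q α τ a b ξ) := by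
  have ht : q ^ τ ≠ 0 := by simp [Complex.cpow_eq_zero_iff, hq0]
  refine .mul hq1 (.prod hq1 _ _ fun i _ => .mul hq1 (expansible_latticePow hq0 hq1 hv _ _ i)
    (.prod hq1 _ _ fun r _ => ?_)) (.prod hq1 _ _ fun p hp => .mul hq1
      (expansible_latticePow hq0 hq1 hv _ _ p.1) ?_)
  · obtain ⟨h, h'⟩ := hasExpansion_qPoch_div hq0 hq1 (x := q * (a r)⁻¹ * ξ i) (y := b r * ξ i)
      (mul_ne_zero (mul_ne_zero hq0 (inv_ne_zero (ha r))) (hξ i)) (mul_ne_zero (hb r) (hξ i))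
      (hpole.1 r i)
    have := Expansible.comp_apply hq0 hq1 hv (ψ := fun l => qPoch q (q * (a r)⁻¹ * ξ i * q ^ l) /
      qPoch q (b r * ξ i * q ^ l)) h h' i
    simpa only [latticePt, mul_assoc] using this
  · have hlt := (Finset.mem_filter.mp hp).2
    have hdiv : ξ p.2 / ξ p.1 ≠ 0 := div_ne_zero (hξ _) (hξ _)
    obtain ⟨h, h'⟩ := hasExpansion_qPoch_div hq0 hq1 (x := q * (q ^ τ)⁻¹ * (ξ p.2 / ξ p.1))
      (y := q ^ τ * (ξ p.2 / ξ p.1)) (mul_ne_zero (mul_ne_zero hq0 (inv_ne_zero ht)) hdiv)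
      (mul_ne_zero ht hdiv) (hpole.2 p.1 p.2 hlt)
    have := Expansible.comp_sub hq0 hq1 hv (ψ := fun l => qPoch q (q * (q ^ τ)⁻¹ *
      (ξ p.2 / ξ p.1) * q ^ l) / qPoch q (q ^ τ * (ξ p.2 / ξ p.1) * q ^ l)) h h' hlt.ne'
    simpa only [latticePt_div hq0, mul_assoc] using this

/-! ### The `q`-difference equations of `Φ` -/

theorem latticePow_add_one {q : ℂ} (hq0 : q ≠ 0) (x s : ℂ) (l : ℤ) :
    latticePow q x s (l + 1) = q ^ s * latticePow q x s l := by
  have hs : q ^ s ≠ 0 := by simp [Complex.cpow_eq_zero_iff, hq0]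
  rw [latticePow, latticePow, zpow_add_one₀ hs]
  ring

theorem latticePt_add_single_same {q : ℂ} (hq0 : q ≠ 0) (ξ : Fin n → ℂ) (ν : Fin n → ℤ)
    (j : Fin n) : latticePt q ξ (ν + Pi.single j 1) j = q * latticePt q ξ ν j := by
  rw [latticePt, latticePt, Pi.add_apply, Pi.single_eq_same, zpow_add_one₀ hq0]
  ring

theorem latticePt_add_single_of_ne (q : ℂ) (ξ : Fin n → ℂ) (ν : Fin n → ℤ) {i j : Fin n}
    (hij : i ≠ j) : latticePt q ξ (ν + Pi.single j 1) i = latticePt q ξ ν i := by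
  rw [latticePt, latticePt, Pi.add_apply, Pi.single_eq_of_ne hij, add_zero]

theorem prod_pairs_containing (j : Fin n) (c : Fin n → ℂ) :
    ∏ p : Fin n × Fin n with p.1 < p.2,
      (if p.1 = j then c p.2 else if p.2 = j then c p.1 else 1) = ∏ k with k ≠ j, c k := by
  have h1 : ∀ p ∈ (Finset.univ : Finset (Fin n × Fin n)).filter (fun p => p.1 < p.2),
      (if p.1 = j then c p.2 else if p.2 = j then c p.1 else 1) =
      (if p.1 = j then c p.2 else 1) * if p.2 = j then c p.1 else 1 := by
    intro p hp
    have hlt := (Finset.mem_filter.mp hp).2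
    by_cases h : p.1 = j
    · have h' : p.2 ≠ j := fun h' => hlt.ne (h.trans h'.symm)
      simp [h, h']
    · simp [h]
  rw [Finset.prod_congr rfl h1, Finset.prod_mul_distrib]
  have h2 : ∏ p : Fin n × Fin n with p.1 < p.2, (if p.1 = j then c p.2 else 1) =
      ∏ k with j < k, c k := by
    rw [Finset.prod_filter, Finset.prod_filter, Fintype.prod_prod_type]
    refine (Finset.prod_eq_single j (fun x _ hx => ?_) (by simp)).trans (by simp)
    simp [hx]
  have h3 : ∏ p : Fin n × Fin n with p.1 < p.2, (if p.2 = j then c p.1 else 1) =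
      ∏ k with k < j, c k := by
    rw [Finset.prod_filter, Finset.prod_filter, Fintype.prod_prod_type_right]
    refine (Finset.prod_eq_single j (fun x _ hx => ?_) (by simp)).trans (by simp)
    simp [hx]
  rw [h2, h3, ← Finset.prod_union]
  · refine Finset.prod_congr ?_ fun _ _ => rfl
    ext k
    simp only [Finset.mem_union, Finset.mem_filter, Finset.mem_univ, true_and]
    exact or_comm.trans lt_or_lt_iff_ne
  · exact Finset.disjoint_filter.mpr fun k _ hk hk' => lt_asymm hk hk'

theorem one_sub_mul_qPoch_div {q : ℂ} (hq1 : ‖q‖ < 1) {x y : ℂ} (hy : y ≠ 1) :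
    (1 - x) * (qPoch q (q * x) / qPoch q (q * y)) = (1 - y) * (qPoch q x / qPoch q y) := by
  have hy' : 1 - y ≠ 0 := sub_ne_zero.mpr hy.symm
  rw [qPoch_eq_mul hq1 x, qPoch_eq_mul hq1 y, mul_div_mul_comm,
    ← mul_assoc (1 - y), mul_div_cancel₀ _ hy']

/-- The ratio of `Φ` at `(z_1, …, q z_j, …, z_n)` and at `z` is a rational function of `z` that
depends on `j` only through the distinguished variable, although the pairs of variables are ordered
in `Φ`. The denominators are cleared, so that zeros of `Φ` do no harm. -/
theorem Phi_add_single {q α τ : ℂ} (hq0 : q ≠ 0) (hq1 : ‖q‖ < 1) (a : Fin m → ℂ) {b : Fin m → ℂ}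
    {ξ : Fin n → ℂ} (hξ : ∀ j, ξ j ≠ 0) (hpole : PoleFree q τ b ξ) (ν : Fin n → ℤ) (j : Fin n) :
    (∏ r, (1 - q * (a r)⁻¹ * latticePt q ξ ν j)) *
        (∏ k with k ≠ j, (q * latticePt q ξ ν j - q ^ τ * latticePt q ξ ν k)) *
        Phi q α τ a b ξ (ν + Pi.single j 1) =
      q ^ α * (∏ r, (1 - b r * latticePt q ξ ν j)) *
        (∏ k with k ≠ j, ((q ^ τ) ^ 2 * (latticePt q ξ ν j - (q ^ τ)⁻¹ * latticePt q ξ ν k))) *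
        Phi q α τ a b ξ ν := by
  have ht : q ^ τ ≠ 0 := by simp [Complex.cpow_eq_zero_iff, hq0]
  have hz (i) : latticePt q ξ ν i ≠ 0 := mul_ne_zero (hξ i) (zpow_ne_zero _ hq0)
  set t := q ^ τ with ht_def
  set z := latticePt q ξ ν with hz_def
  set ν' : Fin n → ℤ := ν + Pi.single j 1 with hν'
  have hsame : latticePt q ξ ν' j = q * z j :=
    latticePt_add_single_same hq0 ξ ν j
  have hother (i) (hi : i ≠ j) : latticePt q ξ ν' i = z i :=
    latticePt_add_single_of_ne q ξ ν hi
  have hνsame : ν' j = ν j + 1 := by simp [hν']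
  have hνother (i) (hi : i ≠ j) : ν' i = ν i := by simp [hν', hi]
  have hone : (∏ r, (1 - q * (a r)⁻¹ * z j)) *
      (∏ i, (latticePow q (ξ i) α (ν' i) *
        ∏ r, qPoch q (q * (a r)⁻¹ * latticePt q ξ ν' i) /
          qPoch q (b r * latticePt q ξ ν' i))) =
      q ^ α * (∏ r, (1 - b r * z j)) *
      ∏ i, (latticePow q (ξ i) α (ν i) *
        ∏ r, qPoch q (q * (a r)⁻¹ * z i) / qPoch q (b r * z i)) := by
    rw [← Finset.mul_prod_erase _ _ (Finset.mem_univ j),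
      ← Finset.mul_prod_erase _ _ (Finset.mem_univ j), ← mul_assoc (∏ r, _),
      ← mul_assoc (q ^ α * ∏ r, _)]
    congr 1
    · rw [hsame, hνsame, latticePow_add_one hq0]
      have hr : (∏ r, (1 - q * (a r)⁻¹ * z j)) * ∏ r, qPoch q (q * (a r)⁻¹ * (q * z j)) /
          qPoch q (b r * (q * z j)) =
          (∏ r, (1 - b r * z j)) * ∏ r, qPoch q (q * (a r)⁻¹ * z j) / qPoch q (b r * z j) := by
        rw [← Finset.prod_mul_distrib, ← Finset.prod_mul_distrib]
        refine Finset.prod_congr rfl fun r _ => ?_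
        have h1 : b r * z j ≠ 1 := by
          have := hpole.1 r j (ν j)
          rwa [mul_assoc] at this
        rw [← one_sub_mul_qPoch_div hq1 h1]
        congr 3 <;> ring
      linear_combination (q ^ α * latticePow q (ξ j) α (ν j)) * hr
    · refine Finset.prod_congr rfl fun i hi => ?_
      rw [hother i (Finset.ne_of_mem_erase hi), hνother i (Finset.ne_of_mem_erase hi)]
  have htwo : (∏ k with k ≠ j, (q * z j - t * z k)) *
      (∏ p : Fin n × Fin n with p.1 < p.2,
        (latticePow q (ξ p.1) (2 * τ - 1) (ν' p.1) *
          (qPoch q (q * t⁻¹ * (latticePt q ξ ν' p.2 /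
            latticePt q ξ ν' p.1)) /
          qPoch q (t * (latticePt q ξ ν' p.2 /
            latticePt q ξ ν' p.1))))) =
      (∏ k with k ≠ j, (t ^ 2 * (z j - t⁻¹ * z k))) *
      ∏ p : Fin n × Fin n with p.1 < p.2, (latticePow q (ξ p.1) (2 * τ - 1) (ν p.1) *
        (qPoch q (q * t⁻¹ * (z p.2 / z p.1)) / qPoch q (t * (z p.2 / z p.1)))) := by
    rw [← prod_pairs_containing, ← prod_pairs_containing, ← Finset.prod_mul_distrib,
      ← Finset.prod_mul_distrib]
    refine Finset.prod_congr rfl fun p hp => ?_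
    have hlt := (Finset.mem_filter.mp hp).2
    have hpole' (l : ℤ) : t * (z p.2 / z p.1 * q ^ l) ≠ 1 := by
      have := hpole.2 p.1 p.2 hlt (ν p.2 - ν p.1 + l)
      rwa [zpow_add₀ hq0, mul_assoc, ← mul_assoc (ξ p.2 / ξ p.1), ← latticePt_div hq0] at this
    by_cases h1 : p.1 = j
    · have h2 : p.2 ≠ j := fun h2 => hlt.ne (h1.trans h2.symm)
      rw [if_pos h1, if_pos h1, hother _ h2, h1, hsame, hνsame, latticePow_add_one hq0]
      have hpow : q ^ (2 * τ - 1) = t ^ 2 / q := by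
        rw [Complex.cpow_sub _ _ hq0, Complex.cpow_one, two_mul, Complex.cpow_add _ _ hq0, sq]
      have hx : t * (z p.2 / (q * z j)) ≠ 1 := by
        have := hpole' (-1)
        rw [h1] at this
        convert this using 2
        rw [zpow_neg_one]; field_simp
      have h3 := one_sub_mul_qPoch_div hq1 (x := t⁻¹ * (z p.2 / z j)) hx
      have e1 : q * (t⁻¹ * (z p.2 / z j)) = q * t⁻¹ * (z p.2 / z j) := by ring
      have e2 : q * (t * (z p.2 / (q * z j))) = t * (z p.2 / z j) := by field_simp
      have e3 : q * t⁻¹ * (z p.2 / (q * z j)) = t⁻¹ * (z p.2 / z j) := by field_simp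
      rw [e1, e2] at h3
      rw [e3, hpow]
      have e4 : q * z j - t * z p.2 = q * z j * (1 - t * (z p.2 / (q * z j))) := by
        have := hz j; field_simp
      have e5 : z j - t⁻¹ * z p.2 = z j * (1 - t⁻¹ * (z p.2 / z j)) := by
        have := hz j; field_simp
      rw [e4, e5]
      have e6 : t ^ 2 / q * q = t ^ 2 := div_mul_cancel₀ _ hq0
      linear_combination (-t ^ 2 / q * q * z j * latticePow q (ξ j) (2 * τ - 1) (ν j)) * h3 +
        (z j * latticePow q (ξ j) (2 * τ - 1) (ν j) * ((1 - t⁻¹ * (z p.2 / z j)) *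
          (qPoch q (q * t⁻¹ * (z p.2 / z j)) / qPoch q (t * (z p.2 / z j))))) * e6
    · by_cases h2 : p.2 = j
      · rw [if_neg h1, if_neg h1, if_pos h2, if_pos h2, hother _ h1, h2, hsame, hνother _ h1]
        have hx : t * (z j / z p.1) ≠ 1 := by
          have := hpole' 0
          rwa [h2, zpow_zero, mul_one] at this
        have h3 := one_sub_mul_qPoch_div hq1 (x := q * t⁻¹ * (z j / z p.1)) hx
        have e1 : q * (q * t⁻¹ * (z j / z p.1)) = q * t⁻¹ * (q * z j / z p.1) := by ring
        have e2 : q * (t * (z j / z p.1)) = t * (q * z j / z p.1) := by ring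
        rw [e1, e2] at h3
        have e4 : q * z j - t * z p.1 = -t * z p.1 * (1 - q * t⁻¹ * (z j / z p.1)) := by
          have := hz p.1; field_simp; ring
        have e5 : t ^ 2 * (z j - t⁻¹ * z p.1) = -t * z p.1 * (1 - t * (z j / z p.1)) := by
          have := hz p.1; field_simp; ring
        rw [e4, e5]
        linear_combination (-t * z p.1 * latticePow q (ξ p.1) (2 * τ - 1) (ν p.1)) * h3
      · rw [if_neg h1, if_neg h1, if_neg h2, if_neg h2, hother _ h1, hother _ h2, hνother _ h1]
  unfold Phi
  rw [← ht_def, ← hz_def]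
  calc _ = ((∏ r, (1 - q * (a r)⁻¹ * z j)) *
      (∏ i, (latticePow q (ξ i) α (ν' i) *
        ∏ r, qPoch q (q * (a r)⁻¹ * latticePt q ξ ν' i) /
          qPoch q (b r * latticePt q ξ ν' i)))) *
      ((∏ k with k ≠ j, (q * z j - t * z k)) *
      (∏ p : Fin n × Fin n with p.1 < p.2,
        (latticePow q (ξ p.1) (2 * τ - 1) (ν' p.1) *
          (qPoch q (q * t⁻¹ * (latticePt q ξ ν' p.2 /
            latticePt q ξ ν' p.1)) /
          qPoch q (t * (latticePt q ξ ν' p.2 /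
            latticePt q ξ ν' p.1)))))) := by ring
    _ = _ := by rw [hone, htwo]; ring

end Integrand

/-! ### Moving variables under skew-symmetrization -/

section Skew

variable {n : ℕ}

theorem skew_add (f g : MvPolynomial (Fin n) ℂ) : skew (f + g) = skew f + skew g := by
  simp [skew, mul_add, Finset.sum_add_distrib]

theorem skew_C_mul (c : ℂ) (f : MvPolynomial (Fin n) ℂ) : skew (C c * f) = C c * skew f := by
  simp only [skew, Finset.mul_sum, map_mul, rename_C]
  exact Finset.sum_congr rfl fun σ _ => by ring

theorem skew_sub (f g : MvPolynomial (Fin n) ℂ) : skew (f - g) = skew f - skew g := by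
  simp [skew, mul_sub, Finset.sum_sub_distrib]

theorem skew_rename (τ : Equiv.Perm (Fin n)) (f : MvPolynomial (Fin n) ℂ) :
    skew (rename τ f) = C ((Equiv.Perm.sign τ : ℤ) : ℂ) * skew f := by
  unfold skew
  rw [Finset.mul_sum]
  refine Fintype.sum_equiv (Equiv.mulRight τ) _ _ fun σ => ?_
  have h : (((Equiv.Perm.sign τ : ℤ) : ℂ)) * (((Equiv.Perm.sign τ : ℤ) : ℂ)) = 1 := by
    norm_cast
    rw [Int.units_mul_self, Units.val_one]
  rw [rename_rename, Equiv.coe_mulRight, Equiv.Perm.sign_mul, Equiv.Perm.coe_mul, ← mul_assoc,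
    ← map_mul]
  congr 2
  push_cast
  linear_combination (-((Equiv.Perm.sign σ : ℤ) : ℂ)) * h

theorem skew_eq_zero {i j : Fin n} (hij : i ≠ j) {f : MvPolynomial (Fin n) ℂ}
    (hf : rename (Equiv.swap i j) f = f) : skew f = 0 := by
  have h := skew_rename (Equiv.swap i j) f
  rw [hf, Equiv.Perm.sign_swap hij] at h
  simpa [self_eq_neg] using h

theorem rename_prod_filter (σ : Equiv.Perm (Fin n)) (P : Fin n → Prop) [DecidablePred P]
    (g : Fin n → MvPolynomial (Fin n) ℂ) (hg : ∀ j, rename σ (g j) = g (σ j))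
    (hP : ∀ j, P (σ j) ↔ P j) :
    rename σ (∏ j with P j, g j) = ∏ j with P j, g j := by
  rw [map_prod]
  exact Finset.prod_equiv σ (by simp [hP]) fun j _ => hg j

/-- Away from its factor at an adjacent pair, the deformed difference product is invariant under
the transposition of that pair. -/
theorem exists_vandermondeT_eq_mul (t : ℂ) {p p' : Fin n} (hp : p.val + 1 = p'.val) :
    ∃ V, vandermondeT n t = (X p - C t⁻¹ * X p') * V ∧ rename (Equiv.swap p p') V = V := by
  have hlt : p < p' := Fin.lt_def.mpr (by omega)
  have hmem : (p, p') ∈ (Finset.univ : Finset (Fin n × Fin n)).filter fun x => x.1 < x.2 := by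
    simpa using hlt
  refine ⟨_, (Finset.mul_prod_erase _ _ hmem).symm, ?_⟩
  rw [map_prod]
  refine Finset.prod_equiv (Equiv.prodCongr (Equiv.swap p p') (Equiv.swap p p')) ?_ ?_
  · rintro ⟨x, y⟩
    simp only [Finset.mem_erase, ne_eq, Prod.mk.injEq, Finset.mem_filter, Finset.mem_univ, true_and,
      Equiv.prodCongr_apply, Prod.map_apply, Equiv.swap_apply_def, Fin.lt_def, Fin.ext_iff]
    split_ifs <;> omega
  · rintro ⟨x, y⟩ -
    simp

/-- For `f` symmetric in `z_p, z_{p+1}`, the polynomials `z_{p+1} (z_p - t⁻¹ z_{p+1})` and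
`t⁻¹ z_p (z_p - t⁻¹ z_{p+1})` differ by a symmetric one. -/
theorem skew_vandermondeT_mul_X_succ (t : ℂ) {p p' : Fin n} (hp : p.val + 1 = p'.val)
    {R : MvPolynomial (Fin n) ℂ} (hR : rename (Equiv.swap p p') R = R) :
    skew (vandermondeT n t * R * X p') = C t⁻¹ * skew (vandermondeT n t * R * X p) := by
  obtain ⟨V, hV, hVs⟩ := exists_vandermondeT_eq_mul t hp
  have hne : p ≠ p' := Fin.ne_of_val_ne (by omega)
  rw [← skew_C_mul, ← sub_eq_zero, ← skew_sub]
  have h : vandermondeT n t * R * X p' - C t⁻¹ * (vandermondeT n t * R * X p) =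
      V * R * ((1 + C t⁻¹ * C t⁻¹) * (X p * X p') - C t⁻¹ * (X p * X p + X p' * X p')) := by
    rw [hV]; ring
  rw [h]
  refine skew_eq_zero hne ?_
  simp only [map_mul, map_sub, map_add, map_one, rename_C, rename_X, hR, hVs,
    Equiv.swap_apply_left, Equiv.swap_apply_right]
  ring

/-- `R` is invariant under the adjacent transpositions of the coordinates `l, …, r`. -/
def SymmOn (l r : ℕ) (R : MvPolynomial (Fin n) ℂ) : Prop :=
  ∀ p p' : Fin n, l ≤ p.val → p.val + 1 = p'.val → p'.val ≤ r → rename (Equiv.swap p p') R = R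

theorem SymmOn.mul {l r : ℕ} {R S : MvPolynomial (Fin n) ℂ} (hR : SymmOn l r R)
    (hS : SymmOn l r S) : SymmOn l r (R * S) := fun p p' h1 h2 h3 => by
  rw [map_mul, hR p p' h1 h2 h3, hS p p' h1 h2 h3]

theorem SymmOn.prod_filter {l r : ℕ} (P : ℕ → Prop) [DecidablePred P]
    (g : Fin n → MvPolynomial (Fin n) ℂ)
    (hg : ∀ (σ : Equiv.Perm (Fin n)) j, rename σ (g j) = g (σ j))
    (hP : ∀ p, l ≤ p → p < r → (P p ↔ P (p + 1))) :
    SymmOn l r (∏ j : Fin n with P j.val, g j) := by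
  intro p p' h1 h2 h3
  refine rename_prod_filter _ _ g (hg _) fun j => ?_
  have h := hP p h1 (by omega)
  rw [h2] at h
  rw [Equiv.swap_apply_def]
  split_ifs with h4 h5
  · rw [h4, h]
  · rw [h5, h]
  · rfl

theorem skew_vandermondeT_mul_X (t : ℂ) {l r : ℕ} (hlr : l ≤ r) (hr : r < n)
    {R : MvPolynomial (Fin n) ℂ} (hR : SymmOn l r R) :
    skew (vandermondeT n t * R * X ⟨r, hr⟩) =
      C (t⁻¹ ^ (r - l)) * skew (vandermondeT n t * R * X ⟨l, hlr.trans_lt hr⟩) := by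
  induction r, hlr using Nat.le_induction with
  | base => simp
  | succ r hlr ih =>
    rw [skew_vandermondeT_mul_X_succ t (p := ⟨r, by omega⟩) rfl (hR _ _ hlr rfl le_rfl),
      ih (by omega) fun p p' h1 h2 h3 => hR p p' h1 h2 (by omega), ← mul_assoc, ← map_mul,
      ← pow_succ', Nat.sub_add_comm hlr]

/-- The monomial `z_1 ⋯ z_k` with one factor omitted. -/
def omitMonomial (n k l : ℕ) : MvPolynomial (Fin n) ℂ :=
  ∏ j : Fin n with j.val < k ∧ j.val ≠ l, X j

theorem X_mul_omitMonomial {k : ℕ} (l : Fin n) (hl : l.val < k) :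
    X l * omitMonomial n k l = ∏ j : Fin n with j.val < k, X j := by
  have hmem : l ∈ (Finset.univ : Finset (Fin n)).filter fun j => j.val < k := by simpa using hl
  rw [← Finset.mul_prod_erase _ _ hmem, omitMonomial]
  congr 1
  refine Finset.prod_congr ?_ fun _ _ => rfl
  ext j
  simp [Fin.ext_iff, and_comm]

theorem omitMonomial_last (n k : ℕ) :
    omitMonomial n k (k - 1) = ∏ j : Fin n with j.val < k - 1, X j := by
  refine Finset.prod_congr ?_ fun _ _ => rfl
  ext j
  simp only [Finset.mem_filter, Finset.mem_univ, true_and]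
  omega

theorem skew_vandermondeT_mul_omitMonomial (t : ℂ) {l r k : ℕ} (hlr : l ≤ r) (hrk : r < k)
    (hk : k ≤ n) {R : MvPolynomial (Fin n) ℂ} (hR : SymmOn l r R) :
    skew (vandermondeT n t * R * omitMonomial n k l) =
      C (t⁻¹ ^ (r - l)) * skew (vandermondeT n t * R * omitMonomial n k r) := by
  induction r, hlr using Nat.le_induction with
  | base => simp
  | succ r hlr ih =>
    rw [ih (by omega) fun p p' h1 h2 h3 => hR p p' h1 h2 (by omega)]
    set p : Fin n := ⟨r, by omega⟩
    set p' : Fin n := ⟨r + 1, by omega⟩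
    set S : MvPolynomial (Fin n) ℂ :=
      ∏ j : Fin n with (j.val < k ∧ j.val ≠ r ∧ j.val ≠ r + 1), X j with hS
    have h1 : omitMonomial n k r = S * X p' := by
      have hmem : p' ∈ (Finset.univ : Finset (Fin n)).filter fun j => j.val < k ∧ j.val ≠ r := by
        simp [p', hrk]
      rw [omitMonomial, ← Finset.prod_erase_mul _ _ hmem, hS]
      congr 1
      refine Finset.prod_congr ?_ fun _ _ => rfl
      ext j
      simp only [Finset.mem_erase, Finset.mem_filter, Finset.mem_univ, true_and, Fin.ext_iff, p',
        ne_eq]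
      tauto
    have h2 : omitMonomial n k (r + 1) = S * X p := by
      have hmem : p ∈ (Finset.univ : Finset (Fin n)).filter
          fun j => j.val < k ∧ j.val ≠ r + 1 := by
        simp only [Finset.mem_filter, Finset.mem_univ, true_and, p]; omega
      rw [omitMonomial, ← Finset.prod_erase_mul _ _ hmem, hS]
      congr 1
      refine Finset.prod_congr ?_ fun _ _ => rfl
      ext j
      simp only [Finset.mem_erase, Finset.mem_filter, Finset.mem_univ, true_and, Fin.ext_iff, p,
        ne_eq]
      tauto
    have hSs : rename (Equiv.swap p p') (R * S) = R * S := by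
      rw [map_mul, hR p p' hlr rfl le_rfl]
      congr 1
      refine rename_prod_filter _ _ _ (by simp) fun j => ?_
      rw [Equiv.swap_apply_def]
      split_ifs with h4 h5
      · simp [h4, p, p']
      · simp [h5, p, p']
      · rfl
    rw [h1, h2, ← mul_assoc, ← mul_assoc, mul_assoc _ R S,
      skew_vandermondeT_mul_X_succ t rfl hSs, ← mul_assoc, ← map_mul, ← pow_succ,
      Nat.sub_add_comm hlr]

end Skew

/-! ### Relations among the skew-symmetrized interpolation polynomials -/

section Interpolation

variable {n : ℕ}

/-- The linear factors `∏_{j ≤ n-i} (1 - b z_j) ∏_{j > n-i} (1 - a⁻¹ z_j)` of `E_{k,i}`. -/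
def linearFactors (n : ℕ) (a b : ℂ) (i : ℕ) : MvPolynomial (Fin n) ℂ :=
  (∏ j : Fin n with j.val + i < n, (1 - C b * X j)) *
    ∏ j : Fin n with n ≤ j.val + i, (1 - C a⁻¹ * X j)

theorem interp_eq (t a b : ℂ) (k i : ℕ) : interp n t a b k i =
    vandermondeT n t * linearFactors n a b i * ∏ j : Fin n with j.val < k, X j := by
  rw [interp, linearFactors]; ring

theorem symmOn_linearFactors (a b : ℂ) {i l r : ℕ} (h : r + i < n ∨ n ≤ l + i) :
    SymmOn l r (linearFactors n a b i) :=
  .mul (.prod_filter (fun j => j + i < n) _ (by simp) fun p h1 h2 => by omega)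
    (.prod_filter (fun j => n ≤ j + i) _ (by simp) fun p h1 h2 => by omega)

theorem symmOn_prod_X {k l r : ℕ} (h : k ≤ l) :
    SymmOn l r (∏ j : Fin n with j.val < k, X j) :=
  .prod_filter (fun j => j < k) _ (by simp) fun p h1 h2 => by omega

theorem exists_linearFactors_eq (a b : ℂ) {i : ℕ} (r : Fin n) (hr : r.val + i + 1 = n) :
    ∃ B, linearFactors n a b i = (1 - C b * X r) * B ∧
      linearFactors n a b (i + 1) = (1 - C a⁻¹ * X r) * B := by
  refine ⟨(∏ j : Fin n with j.val + (i + 1) < n, (1 - C b * X j)) *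
    ∏ j : Fin n with n ≤ j.val + i, (1 - C a⁻¹ * X j), ?_, ?_⟩
  · have hmem : r ∈ (Finset.univ : Finset (Fin n)).filter fun j => j.val + i < n := by
      simp only [Finset.mem_filter, Finset.mem_univ, true_and]; omega
    rw [linearFactors, ← Finset.mul_prod_erase _ _ hmem, mul_assoc]
    congr 3
    ext j
    simp only [Finset.mem_erase, Finset.mem_filter, Finset.mem_univ, true_and, Fin.ext_iff, ne_eq]
    omega
  · have hmem : r ∈ (Finset.univ : Finset (Fin n)).filter fun j => n ≤ j.val + (i + 1) := by
      simp only [Finset.mem_filter, Finset.mem_univ, true_and]; omega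
    rw [linearFactors, ← Finset.mul_prod_erase _ _ hmem, mul_left_comm]
    congr 3
    ext j
    simp only [Finset.mem_erase, Finset.mem_filter, Finset.mem_univ, true_and, Fin.ext_iff, ne_eq]
    omega

theorem interp_mul_X (t a b : ℂ) {k : ℕ} (hk : 1 ≤ k) (hkn : k ≤ n) (i : ℕ) :
    vandermondeT n t * (linearFactors n a b i * ∏ j : Fin n with j.val < k - 1, X j) *
      X ⟨k - 1, by omega⟩ = interp n t a b k i := by
  rw [interp_eq, ← X_mul_omitMonomial (k := k) ⟨k - 1, by omega⟩ (by simp only; omega),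
    omitMonomial_last]
  ring

/-- `z_n E_{k-1,i+1}` when `i + k ≤ n`: the variable moves to the boundary of the two blocks of
linear factors, where `z (1 - z/a)` is a combination of `z (1 - bz)`, `1 - bz` and `1 - z/a`. -/
theorem skew_interp_mul_X_last_of_le (t a : ℂ) {b : ℂ} (hb : b ≠ 0) {k i : ℕ}
    (hk : 1 ≤ k) (hik : i + k ≤ n) :
    skew (interp n t a b (k - 1) (i + 1) * X ⟨n - 1, by omega⟩) =
      C (t⁻¹ ^ i * b⁻¹) * (C (a⁻¹ * t⁻¹ ^ (n - i - k)) * skew (interp n t a b k i) -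
        skew (interp n t a b (k - 1) i) + skew (interp n t a b (k - 1) (i + 1))) := by
  set r : Fin n := ⟨n - 1 - i, by omega⟩ with hr
  obtain ⟨B, hB, hB'⟩ := exists_linearFactors_eq a b (i := i) r (by simp only [hr]; omega)
  have h1 := skew_vandermondeT_mul_X t (l := n - 1 - i) (r := n - 1) (by omega) (by omega)
    ((symmOn_linearFactors (n := n) a b (i := i + 1) (Or.inr (by omega))).mul
      (symmOn_prod_X (k := k - 1) (by omega)))
  have h2 := skew_vandermondeT_mul_X t (l := k - 1) (r := n - 1 - i) (by omega) (by omega)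
    ((symmOn_linearFactors (n := n) a b (i := i) (Or.inl (by omega))).mul
      (symmOn_prod_X (k := k - 1) (by omega)))
  rw [interp_mul_X t a b hk (by omega), show n - 1 - i - (k - 1) = n - i - k by omega] at h2
  rw [show n - 1 - (n - 1 - i) = i by omega] at h1
  have h3 : vandermondeT n t * (linearFactors n a b (i + 1) *
      ∏ j : Fin n with j.val < k - 1, X j) * X r =
      C (b⁻¹ * a⁻¹) * (vandermondeT n t * (linearFactors n a b i *
        ∏ j : Fin n with j.val < k - 1, X j) * X r) -
      C b⁻¹ * interp n t a b (k - 1) i + C b⁻¹ * interp n t a b (k - 1) (i + 1) := by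
    have hbb : (C b⁻¹ * C b : MvPolynomial (Fin n) ℂ) = 1 := by
      rw [← C_mul, inv_mul_cancel₀ hb, C_1]
    rw [interp_eq, interp_eq, hB, hB', C_mul]
    linear_combination (vandermondeT n t * B * (∏ j : Fin n with j.val < k - 1, X j) * X r *
      (C a⁻¹ * X r - 1)) * hbb
  rw [interp_eq t a b (k - 1) (i + 1), mul_assoc (vandermondeT n t), h1, h3, skew_add, skew_sub,
    skew_C_mul, skew_C_mul, skew_C_mul, h2, ← mul_assoc (vandermondeT n t), ← interp_eq]
  simp only [C_mul]
  ring

theorem skew_interp_mul_X_last_of_ge (t a b : ℂ) {k i : ℕ} (hk : 1 ≤ k) (hkn : k ≤ n)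
    (hik : n ≤ i + k) :
    skew (interp n t a b (k - 1) (i + 1) * X ⟨n - 1, by omega⟩) =
      C (t⁻¹ ^ (n - k)) * skew (interp n t a b k (i + 1)) := by
  have h1 := skew_vandermondeT_mul_X t (l := k - 1) (r := n - 1) (by omega) (by omega)
    ((symmOn_linearFactors (n := n) a b (i := i + 1) (Or.inr (by omega))).mul
      (symmOn_prod_X (k := k - 1) (by omega)))
  rw [interp_mul_X t a b hk hkn, show n - 1 - (k - 1) = n - k by omega] at h1
  rw [interp_eq, mul_assoc (vandermondeT n t), h1]

theorem skew_omitMonomial_zero_of_le (t a b : ℂ) {k i : ℕ} (hk : 1 ≤ k) (hik : i + k ≤ n) :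
    skew (vandermondeT n t * linearFactors n a b i * omitMonomial n k 0) =
      C (t⁻¹ ^ (k - 1)) * skew (interp n t a b (k - 1) i) := by
  rw [skew_vandermondeT_mul_omitMonomial t (Nat.zero_le (k - 1)) (by omega) (by omega)
    (symmOn_linearFactors a b (Or.inl (by omega))), omitMonomial_last, interp_eq, Nat.sub_zero]

/-- `z_2 ⋯ z_k` in place of `z_1 ⋯ z_k` when `n ≤ i + k`: the missing variable moves to the
boundary of the two blocks of linear factors, where `1 - bz` is a combination of `z (1 - bz)`,
`z (1 - z/a)` and `1 - z/a`. -/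
theorem skew_omitMonomial_zero_of_ge (t a b : ℂ) {k i : ℕ}
    (hkn : k ≤ n) (hin : i + 1 ≤ n) (hik : n ≤ i + k) :
    skew (vandermondeT n t * linearFactors n a b i * omitMonomial n k 0) =
      C (t⁻¹ ^ (n - i - 1)) * (C a⁻¹ * skew (interp n t a b k i) -
        C b * skew (interp n t a b k (i + 1)) +
        C (t⁻¹ ^ (i + k - n)) * skew (interp n t a b (k - 1) (i + 1))) := by
  set r : Fin n := ⟨n - 1 - i, by omega⟩ with hr
  obtain ⟨B, hB, hB'⟩ := exists_linearFactors_eq a b (i := i) r (by simp only [hr]; omega)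
  have h1 := skew_vandermondeT_mul_omitMonomial t (Nat.zero_le (n - 1 - i)) (k := k) (by omega)
    (by omega) (symmOn_linearFactors a b (n := n) (i := i) (Or.inl (by omega)))
  have h2 := skew_vandermondeT_mul_omitMonomial t (l := n - 1 - i) (r := k - 1) (k := k)
    (by omega) (by omega) (by omega)
    (symmOn_linearFactors a b (n := n) (i := i + 1) (Or.inr (by omega)))
  rw [omitMonomial_last, ← interp_eq, show k - 1 - (n - 1 - i) = i + k - n by omega] at h2
  have h3 : vandermondeT n t * linearFactors n a b i * omitMonomial n k (n - 1 - i) =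
      C a⁻¹ * interp n t a b k i - C b * interp n t a b k (i + 1) +
      vandermondeT n t * linearFactors n a b (i + 1) * omitMonomial n k (n - 1 - i) := by
    rw [interp_eq, interp_eq, ← X_mul_omitMonomial r (by simp only [hr]; omega), hB, hB']
    ring
  rw [h1, h3, skew_add, skew_sub, skew_C_mul, skew_C_mul, h2, Nat.sub_zero,
    show n - 1 - i = n - i - 1 by omega]

end Interpolation

/-! ### The polynomials of the telescoping sum -/

section Telescoping

variable {m : ℕ}

theorem vandermondeT_succ (m : ℕ) (t : ℂ) : vandermondeT (m + 1) t =
    (∏ l : Fin m, (X 0 - C t⁻¹ * X l.succ)) * rename Fin.succ (vandermondeT m t) := by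
  rw [vandermondeT, vandermondeT, Finset.prod_filter, Finset.prod_filter, Fintype.prod_prod_type,
    Fintype.prod_prod_type, Fin.prod_univ_succ, Fin.prod_univ_succ]
  simp only [Fin.prod_univ_succ, map_prod]
  simp [Fin.succ_lt_succ_iff, apply_ite (rename _)]

theorem vandermondeT_castSucc (m : ℕ) (t : ℂ) : vandermondeT (m + 1) t =
    (∏ l : Fin m, (X l.castSucc - C t⁻¹ * X (Fin.last m))) *
      rename Fin.castSucc (vandermondeT m t) := by
  rw [vandermondeT, vandermondeT, Finset.prod_filter, Finset.prod_filter, Fintype.prod_prod_type,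
    Fintype.prod_prod_type, Fin.prod_univ_castSucc]
  simp only [Fin.prod_univ_castSucc, map_prod]
  simp [apply_ite (rename _), Finset.prod_mul_distrib, mul_comm, Fin.castSucc_lt_last,
    (Fin.castSucc_lt_last _).not_gt]

theorem interp_castSucc (t a b : ℂ) {k i : ℕ} (hk : 1 ≤ k) (hkm : k ≤ m + 1) :
    interp (m + 1) t a b (k - 1) (i + 1) =
      (1 - C a⁻¹ * X (Fin.last m)) * (∏ l : Fin m, (X l.castSucc - C t⁻¹ * X (Fin.last m))) *
        rename Fin.castSucc (interp m t a b (k - 1) i) := by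
  have h1 (j : Fin m) : j.val + (i + 1) < m + 1 ↔ j.val + i < m := by omega
  have h2 (j : Fin m) : m + 1 ≤ j.val + (i + 1) ↔ m ≤ j.val + i := by omega
  rw [interp, vandermondeT_castSucc, interp]
  simp only [Finset.prod_filter, Fin.prod_univ_castSucc, map_mul, map_prod, Fin.val_castSucc,
    Fin.val_last, h1, h2, apply_ite (rename _), map_sub, map_one, rename_C, rename_X]
  rw [if_neg (by omega), if_neg (by omega), if_pos (by omega)]
  ring

theorem omitMonomial_succ (t a b : ℂ) {k i : ℕ} (hk : 1 ≤ k) (hi : i ≤ m) :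
    vandermondeT (m + 1) t * linearFactors (m + 1) a b i * omitMonomial (m + 1) k 0 =
      (1 - C b * X 0) * (∏ l : Fin m, (X 0 - C t⁻¹ * X l.succ)) *
        rename Fin.succ (interp m t a b (k - 1) i) := by
  have h1 (j : Fin m) : j.val + 1 + i < m + 1 ↔ j.val + i < m := by omega
  have h2 (j : Fin m) : m + 1 ≤ j.val + 1 + i ↔ m ≤ j.val + i := by omega
  have h3 (j : Fin m) : (j.val + 1 < k ∧ j.val + 1 ≠ 0) ↔ j.val < k - 1 := by omega
  have h4 : ((0 : Fin (m + 1)) : ℕ) + i < m + 1 := by rw [Fin.val_zero]; omega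
  have h5 : ¬ m + 1 ≤ ((0 : Fin (m + 1)) : ℕ) + i := by rw [Fin.val_zero]; omega
  have h6 : ¬ (((0 : Fin (m + 1)) : ℕ) < k ∧ ((0 : Fin (m + 1)) : ℕ) ≠ 0) := by
    rw [Fin.val_zero]; omega
  rw [linearFactors, omitMonomial, vandermondeT_succ, interp]
  simp only [Finset.prod_filter, Fin.prod_univ_succ, map_mul, map_prod, Fin.val_succ,
    h1, h2, h3, h4, h5, h6, apply_ite (rename _), map_sub, map_one, rename_C, rename_X, if_true,
    if_false]
  ring

/-- The polynomial `∏_r (1 - z_1/a_r) ∏_{l>1} (z_1 - t z_l) Q(z_2, …, z_n)`. -/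
def telescopeNum {M : ℕ} (t : ℂ) (a : Fin M → ℂ) (Q : MvPolynomial (Fin m) ℂ) :
    MvPolynomial (Fin (m + 1)) ℂ :=
  (∏ r, (1 - C (a r)⁻¹ * X 0)) * (∏ l : Fin m, (X 0 - C t * X l.succ)) * rename Fin.succ Q

/-- The polynomial `∏_r (1 - b_r z_1) ∏_{l>1} (z_1 - t⁻¹ z_l) Q(z_2, …, z_n)`, which up to a
constant is `telescopeNum` at `(q z_1, z_2, …, z_n)` times `Φ(q z_1, z_2, …, z_n) / Φ(z)`. -/
def telescopeShift {M : ℕ} (t : ℂ) (b : Fin M → ℂ) (Q : MvPolynomial (Fin m) ℂ) :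
    MvPolynomial (Fin (m + 1)) ℂ :=
  (∏ r, (1 - C (b r) * X 0)) * (∏ l : Fin m, (X 0 - C t⁻¹ * X l.succ)) * rename Fin.succ Q

theorem skew_telescopeNum {t : ℂ} (ht : t ≠ 0) (a₁ a₂ b : ℂ) {k i : ℕ} (hk : 1 ≤ k)
    (hkm : k ≤ m + 1) :
    skew (telescopeNum t ![a₁, a₂] (interp m t a₁ b (k - 1) i)) =
      C (t ^ m) * (skew (interp (m + 1) t a₁ b (k - 1) (i + 1)) -
        C a₂⁻¹ * skew (interp (m + 1) t a₁ b (k - 1) (i + 1) * X (Fin.last m))) := by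
  have htt : (C t * C t⁻¹ : MvPolynomial (Fin (m + 1)) ℂ) = 1 := by
    rw [← C_mul, mul_inv_cancel₀ ht, C_1]
  have h1 : telescopeNum t ![a₁, a₂] (interp m t a₁ b (k - 1) i) = rename (finRotate (m + 1))
      (C ((-t) ^ m) * (interp (m + 1) t a₁ b (k - 1) (i + 1) -
        C a₂⁻¹ * (interp (m + 1) t a₁ b (k - 1) (i + 1) * X (Fin.last m)))) := by
    have h2 : (∏ l : Fin m, (X 0 - C t * X l.succ) : MvPolynomial (Fin (m + 1)) ℂ) =
        C ((-t) ^ m) * ∏ l : Fin m, (X l.succ - C t⁻¹ * X 0) := by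
      have h3 (l : Fin m) : (X 0 - C t * X l.succ : MvPolynomial (Fin (m + 1)) ℂ) =
          C (-t) * (X l.succ - C t⁻¹ * X 0) := by
        rw [C_neg]; linear_combination (-X 0) * htt
      simp only [h3, Finset.prod_mul_distrib, Finset.prod_const, Finset.card_univ,
        Fintype.card_fin, C_pow]
    have h4 : (finRotate (m + 1) ∘ Fin.castSucc : Fin m → Fin (m + 1)) = Fin.succ := by
      ext j; simp
    rw [interp_castSucc t a₁ b hk hkm, telescopeNum, h2]
    simp only [map_mul, map_sub, map_prod, map_one, rename_C, rename_X, finRotate_last,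
      rename_rename, h4, Fin.prod_univ_two, Matrix.cons_val_zero, Matrix.cons_val_one]
    have h5 (l : Fin m) : finRotate (m + 1) l.castSucc = l.succ := congrFun h4 l
    simp only [h5]
    ring
  have hsign : (((Equiv.Perm.sign (finRotate (m + 1)) : ℤ) : ℂ)) * (-t) ^ m = t ^ m := by
    rw [sign_finRotate, Nat.add_sub_cancel]
    push_cast
    rw [← mul_pow]; simp
  rw [h1, skew_rename, skew_C_mul, ← mul_assoc, ← C_mul, hsign, skew_sub, skew_C_mul]

theorem skew_telescopeShift (t a b₁ b₂ : ℂ) {k i : ℕ} (hk : 1 ≤ k) (hi : i ≤ m) :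
    skew (telescopeShift t ![b₁, b₂] (interp m t a b₂ (k - 1) i)) =
      skew (vandermondeT (m + 1) t * linearFactors (m + 1) a b₂ i * omitMonomial (m + 1) k 0) -
        C b₁ * skew (interp (m + 1) t a b₂ k i) := by
  have h : telescopeShift t ![b₁, b₂] (interp m t a b₂ (k - 1) i) =
      vandermondeT (m + 1) t * linearFactors (m + 1) a b₂ i * omitMonomial (m + 1) k 0 -
        C b₁ * interp (m + 1) t a b₂ k i := by
    rw [interp_eq (n := m + 1),
      ← X_mul_omitMonomial (0 : Fin (m + 1)) (by rw [Fin.val_zero]; omega), Fin.val_zero,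
      mul_left_comm _ (X 0), omitMonomial_succ t a b₂ hk hi, telescopeShift]
    simp only [Fin.prod_univ_two, Matrix.cons_val_zero, Matrix.cons_val_one]
    ring
  rw [h, skew_sub, skew_C_mul]

end Telescoping

/-! ### Shift invariance of the lattice sum -/

section TelescopingSum

variable {m M : ℕ}

theorem eval_skew {n : ℕ} (z : Fin n → ℂ) (f : MvPolynomial (Fin n) ℂ) :
    eval z (skew f) = ∑ σ : Equiv.Perm (Fin n), ((Equiv.Perm.sign σ : ℤ) : ℂ) * eval (z ∘ σ) f := by
  simp [skew, eval_rename]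

theorem prod_comp_succ (σ : Equiv.Perm (Fin (m + 1))) (c : Fin (m + 1) → ℂ) :
    ∏ l : Fin m, c (σ l.succ) = ∏ k with k ≠ σ 0, c k := by
  have h : ∏ k with k ≠ σ 0, c k = ∏ k with k ≠ 0, c (σ k) :=
    (Finset.prod_equiv σ (by simp) fun _ _ => rfl).symm
  rw [h, Finset.prod_filter, Fin.prod_univ_succ]
  simp

theorem eval_telescopeNum (z : Fin (m + 1) → ℂ) (σ : Equiv.Perm (Fin (m + 1))) (t : ℂ)
    (a : Fin M → ℂ) (Q : MvPolynomial (Fin m) ℂ) :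
    eval (z ∘ σ) (telescopeNum t a Q) = (∏ r, (1 - (a r)⁻¹ * z (σ 0))) *
      (∏ k with k ≠ σ 0, (z (σ 0) - t * z k)) * eval (fun l => z (σ l.succ)) Q := by
  rw [← prod_comp_succ σ fun k => z (σ 0) - t * z k]
  simp [telescopeNum, eval_rename, Function.comp_def]

theorem eval_telescopeShift (z : Fin (m + 1) → ℂ) (σ : Equiv.Perm (Fin (m + 1))) (t : ℂ)
    (b : Fin M → ℂ) (Q : MvPolynomial (Fin m) ℂ) :
    eval (z ∘ σ) (telescopeShift t b Q) = (∏ r, (1 - b r * z (σ 0))) *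
      (∏ k with k ≠ σ 0, (z (σ 0) - t⁻¹ * z k)) * eval (fun l => z (σ l.succ)) Q := by
  rw [← prod_comp_succ σ fun k => z (σ 0) - t⁻¹ * z k]
  simp [telescopeShift, eval_rename, Function.comp_def]

theorem eval_telescopeNum_mul_Phi_add_single {q α τ : ℂ} (hq0 : q ≠ 0) (hq1 : ‖q‖ < 1)
    (a : Fin M → ℂ) {b : Fin M → ℂ} {ξ : Fin (m + 1) → ℂ} (hξ : ∀ j, ξ j ≠ 0)
    (hpole : PoleFree q τ b ξ) (Q : MvPolynomial (Fin m) ℂ) (σ : Equiv.Perm (Fin (m + 1)))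
    (ν : Fin (m + 1) → ℤ) :
    eval (latticePt q ξ (ν + Pi.single (σ 0) 1) ∘ σ) (telescopeNum (q ^ τ) a Q) *
        Phi q α τ a b ξ (ν + Pi.single (σ 0) 1) =
      q ^ α * (q ^ τ) ^ (2 * m) *
        (eval (latticePt q ξ ν ∘ σ) (telescopeShift (q ^ τ) b Q) * Phi q α τ a b ξ ν) := by
  have h := Phi_add_single (α := α) hq0 hq1 a hξ hpole ν (σ 0)
  have h0 : latticePt q ξ (ν + Pi.single (σ 0) 1) (σ 0) = q * latticePt q ξ ν (σ 0) :=
    latticePt_add_single_same hq0 ξ ν (σ 0)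
  have hne (l : Fin m) : latticePt q ξ (ν + Pi.single (σ 0) 1) (σ l.succ) =
      latticePt q ξ ν (σ l.succ) :=
    latticePt_add_single_of_ne q ξ ν (σ.injective.ne (Fin.succ_ne_zero l))
  have hcard : ∏ k : Fin (m + 1) with k ≠ σ 0, (q ^ τ) ^ 2 = (q ^ τ) ^ (2 * m) := by
    rw [← prod_comp_succ σ fun _ => (q ^ τ) ^ 2]
    simp [pow_mul]
  have hprod : ∏ k with k ≠ σ 0, (latticePt q ξ (ν + Pi.single (σ 0) 1) (σ 0) -
      q ^ τ * latticePt q ξ (ν + Pi.single (σ 0) 1) k) =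
      ∏ k with k ≠ σ 0, (q * latticePt q ξ ν (σ 0) - q ^ τ * latticePt q ξ ν k) := by
    refine Finset.prod_congr rfl fun k hk => ?_
    rw [h0, latticePt_add_single_of_ne q ξ ν (Finset.mem_filter.mp hk).2]
  rw [Finset.prod_mul_distrib, hcard] at h
  rw [eval_telescopeNum, eval_telescopeShift, hprod, h0]
  simp only [hne]
  have hr : ∏ r, (1 - (a r)⁻¹ * (q * latticePt q ξ ν (σ 0))) =
      ∏ r, (1 - q * (a r)⁻¹ * latticePt q ξ ν (σ 0)) :=
    Finset.prod_congr rfl fun r _ => by ring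
  rw [hr]
  linear_combination (eval (fun l : Fin m => latticePt q ξ ν (σ l.succ)) Q) * h

/-- The relation between Jackson integrals that comes from the invariance of the sum under shifts
of the lattice. -/
theorem tsum_skew_telescopeNum {q α τ : ℂ} (hq0 : q ≠ 0) (hq1 : ‖q‖ < 1) {a b : Fin M → ℂ}
    (ha : ∀ r, a r ≠ 0) (hb : ∀ r, b r ≠ 0) {ξ : Fin (m + 1) → ℂ} (hξ : ∀ j, ξ j ≠ 0)
    (hpole : PoleFree q τ b ξ) (Q : MvPolynomial (Fin m) ℂ) {A B : ℂ}
    (hA : HasSum (fun ν => eval (latticePt q ξ ν) (skew (telescopeNum (q ^ τ) a Q)) *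
      Phi q α τ a b ξ ν) A)
    (hB : HasSum (fun ν => eval (latticePt q ξ ν) (skew (telescopeShift (q ^ τ) b Q)) *
      Phi q α τ a b ξ ν) B) :
    A = q ^ α * (q ^ τ) ^ (2 * m) * B := by
  set g : Equiv.Perm (Fin (m + 1)) → (Fin (m + 1) → ℤ) → ℂ := fun σ ν =>
    ((Equiv.Perm.sign σ : ℤ) : ℂ) * (eval (latticePt q ξ ν ∘ σ) (telescopeNum (q ^ τ) a Q) *
      Phi q α τ a b ξ ν) with hg
  have hG (ν) : eval (latticePt q ξ ν) (skew (telescopeNum (q ^ τ) a Q)) *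
      Phi q α τ a b ξ ν = ∑ σ, g σ ν := by
    simp only [eval_skew, Finset.sum_mul, hg, mul_assoc]
  have hH (ν : Fin (m + 1) → ℤ) : q ^ α * (q ^ τ) ^ (2 * m) *
      (eval (latticePt q ξ ν) (skew (telescopeShift (q ^ τ) b Q)) * Phi q α τ a b ξ ν) =
      ∑ σ : Equiv.Perm (Fin (m + 1)), g σ (ν + Pi.single (σ 0) (1 : ℤ)) := by
    simp only [hg, eval_telescopeNum_mul_Phi_add_single hq0 hq1 a hξ hpole, eval_skew,
      Finset.sum_mul, Finset.mul_sum]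
    exact Finset.sum_congr rfl fun σ _ => by ring
  have hB' := hB.mul_left (q ^ α * (q ^ τ) ^ (2 * m))
  simp only [hG] at hA
  simp only [hH] at hB'
  rw [← hA.tsum_eq, ← hB'.tsum_eq]
  refine tsum_sum_eq_tsum_sum_shift hq0 hq1 (Nat.succ_pos m) g (fun σ => σ 0)
    (fun σ v hv => ?_) hA.summable hB'.summable
  refine .mul hq1 (.const q v _) (.mul hq1 ?_ (expansible_Phi hq0 hq1 ha hb hξ hpole hv))
  have := expansible_eval hq0 hq1 hv ξ (rename σ (telescopeNum (q ^ τ) a Q))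
  simpa only [eval_rename] using this

end TelescopingSum

end JacksonSelberg

/-! ### The three-term relations -/

open JacksonSelberg in
theorem lemma4p1 (n : ℕ) (q α τ a₁ a₂ b₁ b₂ : ℂ) (ξ : Fin n → ℂ)
    (hq0 : q ≠ 0) (hq1 : ‖q‖ < 1)
    (ha₁ : a₁ ≠ 0) (ha₂ : a₂ ≠ 0) (hb₁ : b₁ ≠ 0) (hb₂ : b₂ ≠ 0)
    (hξ : ∀ j, ξ j ≠ 0)
    (hpole : JacksonSelberg.PoleFree q τ ![b₁, b₂] ξ)
    (t : ℂ) (ht : t = q ^ τ)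
    (E : ℕ → ℕ → MvPolynomial (Fin n) ℂ)
    (hE : ∀ k i, E k i = JacksonSelberg.interpSym n t a₁ b₂ k i)
    (conv : MvPolynomial (Fin n) ℂ → Prop)
    (hconv : conv = JacksonSelberg.Converges q α τ ![a₁, a₂] ![b₁, b₂] ξ)
    (J : MvPolynomial (Fin n) ℂ → ℂ)
    (hJ : J = JacksonSelberg.jackson q α τ ![a₁, a₂] ![b₁, b₂] ξ)
    (k i : ℕ) (hk1 : 1 ≤ k) (hkn : k ≤ n) (hin : i + 1 ≤ n) :
    (i + k ≤ n → conv (E k i) → conv (E (k - 1) i) → conv (E (k - 1) (i + 1)) →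
      (1 - q ^ α * a₁ * a₂ * b₁ * b₂ * t ^ (2 * (n : ℤ) - k - 1)) /
            (a₁ * t ^ ((n : ℤ) - i - k)) * J (E k i)
        = (1 - q ^ α * a₂ * b₂ * t ^ ((n : ℤ) + i - k)) * J (E (k - 1) i)
          - (1 - a₂ * b₂ * t ^ (i : ℤ)) * J (E (k - 1) (i + 1))) ∧
    (n ≤ i + k → conv (E (k - 1) (i + 1)) → conv (E k i) → conv (E k (i + 1)) →
      t ^ ((n : ℤ) - k) * (1 - q ^ α * t ^ ((n : ℤ) - k)) * J (E (k - 1) (i + 1))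
        = a₁⁻¹ * q ^ α * t ^ ((n : ℤ) + i - k) * (1 - a₁ * b₁ * t ^ ((n : ℤ) - i - 1)) * J (E k i)
          + a₂⁻¹ * (1 - q ^ α * a₂ * b₂ * t ^ ((n : ℤ) + i - k)) * J (E k (i + 1))) := by
  obtain ⟨m, rfl⟩ : ∃ m, n = m + 1 := ⟨n - 1, by omega⟩
  have ht0 : t ≠ 0 := by simp [ht, Complex.cpow_eq_zero_iff, hq0]
  set Φ := Phi q α τ ![a₁, a₂] ![b₁, b₂] ξ with hΦ
  set S : ℕ → ℕ → ℂ := fun k i => ∑' ν, MvPolynomial.eval (latticePt q ξ ν)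
    (skew (interp (m + 1) t a₁ b₂ k i)) * Φ ν with hS
  have hint (k i : ℕ) : integrand q α τ ![a₁, a₂] ![b₁, b₂] ξ (E k i) = fun ν =>
      MvPolynomial.eval (latticePt q ξ ν) (skew (interp (m + 1) t a₁ b₂ k i)) * Φ ν := by
    ext ν
    rw [integrand, hE, ← vandermonde_mul_interpSym, map_mul]
    ring
  have hsum {k i : ℕ} (h : conv (E k i)) : HasSum (fun ν => MvPolynomial.eval (latticePt q ξ ν)
      (skew (interp (m + 1) t a₁ b₂ k i)) * Φ ν) (S k i) := by
    rw [hconv, Converges, hint] at h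
    exact h.hasSum
  have hJS (k i : ℕ) : J (E k i) = (1 - q) ^ (m + 1) * S k i := by
    rw [hJ, jackson, hint]
  have hi : i ≤ m := by omega
  have htel {A B : ℂ} := tsum_skew_telescopeNum (α := α) (A := A) (B := B) hq0 hq1
    (a := ![a₁, a₂]) (b := ![b₁, b₂]) (by simp [Fin.forall_fin_two, ha₁, ha₂])
    (by simp [Fin.forall_fin_two, hb₁, hb₂]) hξ hpole (interp m t a₁ b₂ (k - 1) i)
  rw [← ht, ← hΦ, skew_telescopeNum ht0 _ _ _ hk1 hkn, skew_telescopeShift _ _ _ _ hk1 hi] at htel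
  simp only [hJS]
  refine ⟨fun hik h1 h2 h3 => ?_, fun hik h1 h2 h3 => ?_⟩
  · have e := skew_interp_mul_X_last_of_le (n := m + 1) t a₁ hb₂ hk1 hik
    rw [show (⟨m + 1 - 1, by omega⟩ : Fin (m + 1)) = Fin.last m from rfl] at e
    rw [e, skew_omitMonomial_zero_of_le t a₁ b₂ hk1 hik] at htel
    obtain ⟨d, hd⟩ : ∃ d, m + 1 = i + k + d := ⟨m + 1 - (i + k), by omega⟩
    obtain ⟨l, rfl⟩ : ∃ l, k = l + 1 := ⟨k - 1, by omega⟩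
    rw [Nat.add_sub_cancel, show m + 1 - i - (l + 1) = d by omega] at htel
    rw [Nat.add_sub_cancel] at h2 h3 ⊢
    -- both sides of the telescoping relation are combinations of the three given integrals
    have key := htel
      (((hsum h3).sub ((((((hsum h1).mul_left (a₁⁻¹ * t⁻¹ ^ d)).sub (hsum h2)).add
        (hsum h3)).mul_left (t⁻¹ ^ i * b₂⁻¹)).mul_left a₂⁻¹)).mul_left (t ^ m) |>.congr_fun
          fun ν => by simp; ring)
      (((hsum h2).mul_left (t⁻¹ ^ l)).sub ((hsum h1).mul_left b₁) |>.congr_fun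
          fun ν => by simp; ring)
    have z1 : (2 * ((m + 1 : ℕ) : ℤ) - ((l + 1 : ℕ) : ℤ) - 1) = ((i + i + l + d + d : ℕ) : ℤ) := by
      push_cast; omega
    have z2 : (((m + 1 : ℕ) : ℤ) - i - ((l + 1 : ℕ) : ℤ)) = (d : ℤ) := by push_cast; omega
    have z3 : (((m + 1 : ℕ) : ℤ) + i - ((l + 1 : ℕ) : ℤ)) = ((i + i + d : ℕ) : ℤ) := by
      push_cast; omega
    rw [z1, z2, z3]
    simp only [zpow_natCast]
    rw [show m = i + l + d by omega] at key
    have hA : t ^ i ≠ 0 := pow_ne_zero _ ht0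
    have hB : t ^ l ≠ 0 := pow_ne_zero _ ht0
    have hD : t ^ d ≠ 0 := pow_ne_zero _ ht0
    simp only [inv_pow, pow_add, two_mul] at key ⊢
    generalize t ^ i = A at *
    generalize t ^ l = B at *
    generalize t ^ d = D at *
    field_simp at key ⊢
    linear_combination -(1 - q) ^ (m + 1) * key
  · have e := skew_interp_mul_X_last_of_ge (n := m + 1) t a₁ b₂ hk1 hkn hik
    rw [show (⟨m + 1 - 1, by omega⟩ : Fin (m + 1)) = Fin.last m from rfl] at e
    rw [e, skew_omitMonomial_zero_of_ge t a₁ b₂ hkn hin hik] at htel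
    obtain ⟨c, hc⟩ : ∃ c, i + k = m + 1 + c := ⟨i + k - (m + 1), by omega⟩
    obtain ⟨p, hp⟩ : ∃ p, m + 1 = k + p := ⟨m + 1 - k, by omega⟩
    obtain ⟨s, hs⟩ : ∃ s, m = i + s := ⟨m - i, by omega⟩
    rw [show m + 1 - k = p by omega, show m + 1 - i - 1 = s by omega,
      show i + k - (m + 1) = c by omega] at htel
    have key := htel
      ((hsum h1).sub (((hsum h3).mul_left (t⁻¹ ^ p)).mul_left a₂⁻¹) |>.mul_left (t ^ m)
        |>.congr_fun fun ν => by simp; ring)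
      ((((((hsum h2).mul_left a₁⁻¹).sub ((hsum h3).mul_left b₂)).add
        ((hsum h1).mul_left (t⁻¹ ^ c))).mul_left (t⁻¹ ^ s)).sub ((hsum h2).mul_left b₁)
        |>.congr_fun fun ν => by simp; ring)
    have z1 : (((m + 1 : ℕ) : ℤ) - k) = (p : ℤ) := by omega
    have z2 : (((m + 1 : ℕ) : ℤ) + i - k) = ((p + p + c : ℕ) : ℤ) := by omega
    have z3 : (((m + 1 : ℕ) : ℤ) - i - 1) = (s : ℤ) := by omega
    rw [z1, z2, z3]
    simp only [zpow_natCast]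
    rw [show m = s + c + p by omega] at key
    have hS' : t ^ s ≠ 0 := pow_ne_zero _ ht0
    have hC : t ^ c ≠ 0 := pow_ne_zero _ ht0
    have hP : t ^ p ≠ 0 := pow_ne_zero _ ht0
    simp only [inv_pow, pow_add, two_mul] at key ⊢
    generalize t ^ s = A at *
    generalize t ^ c = B at *
    generalize t ^ p = D at *
    field_simp at key ⊢
    linear_combination (1 - q) ^ (m + 1) * key
end
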